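/- All vector spaces are over $\mathbb{C}$. A \emph{superalgebra} is a vector space $L=L_0\oplus L_1$ with a bilinear product $[\cdot,\cdot]$ such that $[L_\alpha,L_\beta]\subseteq L_{\alpha+\beta}$ ($\alpha,\beta\in\mathbb{Z}_2$); an isomorphism of superalgebras is a linear bijection respecting products and parity; ideals are two-sided and graded. A superalgebra is a \emph{Leibniz superalgebra} if $[x,[y,z]]=[[x,y],z]-(-1)^{\alpha\beta}[[x,z],y]$ for all $x\in L$, $y\in L_\alpha$, $z\in L_\beta$. It is \emph{split} if it is the direct sum of two nonzero ideals. A \emph{nilradical} of $L$ is a maximal nilpotent ideal $N$ with $[L,L]\subseteq N$. In all tables below the vectors $e_i$ and $x$ are even, the vectors $y_j$ are odd, products of basis vectors that are not listed are zero, and $e_k=y_k=0$ for $k>n$. Let $n\ge 3$. For $\beta_4,\dots,\beta_n,\delta,\gamma\in\mathbb{C}$ let $H(\beta_4,\dots,\beta_n,\delta,\gamma)$ be the superalgebra with basis $e_1,\dots,e_n,y_1,\dots,y_n$ and products $$\begin{array}{ll} [e_1,e_1]=e_3,\quad [e_i,e_1]=e_{i+1}\ (3\le i\le n-1), & [y_j,e_1]=y_{j+1}\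 (1\le j\le n-1),\\ {}[e_1,y_1]=\tfrac12 y_2,\quad [e_i,y_1]=\tfrac12 y_i\ (3\le i\le n), & [y_1,y_1]=e_1,\quad [y_j,y_1]=e_{j+1}\ (2\le j\le n-1),\\ {}[e_1,e_2]=\sum_{k=4}^{n}\beta_k e_k,\quad [e_2,e_2]=\gamma e_n, & [e_j,e_2]=\sum_{k=4}^{n+2-j}\beta_k e_{j+k-2}\ (3\le j\le n-2),\\ {}[y_1,e_2]=\sum_{k=4}^{n}\beta_k y_{k-1}+\delta y_n, & [y_j,e_2]=\sum_{k=4}^{n+2-j}\beta_k y_{j+k-2}\ (2\le j\le n-2). \end{array}$$ For $b\in\mathbb{C}$ and $r$ in the span of $e_1,\dots,e_n$ let $H(\beta_4,\dots,\beta_n,\delta,\gamma;b,r)$ be the superalgebra with basis $e_1,\dots,e_n,x,y_1,\dots,y_n$ whose products are those of $H(\beta_4,\dots,\beta_n,\delta,\gamma)$ together with $$[y_i,x]=(2i-1)y_i\ (1\le i\le n),\quad [e_1,x]=2e_1,\quad [e_2,x]=b\,e_2,\quad [e_i,x]=2(i-1)e_i\ (3\le i\le n),$$ $$[x,y_1]=-y_1,\qquad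 [x,e_1]=-2e_1,\qquad [x,e_2]=-b\,e_2-r.$$ Define the following superalgebras of this form, where the parameters $\beta_k,\delta,\gamma$ that are not mentioned are zero: \begin{itemize} \item $SH_1(t)$, $4\le t\le n$: $\beta_t=1$, $b=2(t-2)$, $r=2e_{t-1}$; \item $SH_2$: $\delta=1$, $b=2(n-1)$, $r=2e_n$; \item $SH_3(\gamma)$, $\gamma\ne0$, $n\ge 5$ odd: $\beta_{(n+3)/2}=1$, last parameter $\gamma$, $b=n-1$, $r=2e_{(n+1)/2}$; \item $SH_4$: $\gamma=1$, $b=n-1$, $r=0$. \end{itemize} \textbf{Theorem.} Let $L$ be a finite-dimensional, solvable, non-nilpotent Leibniz superalgebra with a nilradical $N$ that is isomorphic to a non-split superalgebra $H(\beta_4,\dots,\beta_n,\delta,\gamma)$. Then $\dim L-\dim N=1$, and $L$ is isomorphic to exactly one of the superalgebras $SH_1(t)$ $(4\le t\le n)$, $SH_2$, $SH_3(\gamma)$ ($n\geq 5$ odd, $\gamma\neq 0$), $SH_4$. Moreover, the superalgebras in this list are pairwise non-isomorphic (as superalgebras; it is not asserted that each of them satisfies the Leibniz superidentity). -/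

import Mathlib

/-- A superalgebra over `ℂ`: a vector space `V` with a decomposition `V = V₀ ⊕ V₁` into an even and
an odd part and a bilinear product `[x, y] = bracket x y` with `[V_α, V_β] ⊆ V_{α + β}`. No identity
is imposed on the product. -/
structure SuperAlgebra (V : Type*) [AddCommGroup V] [Module ℂ V] where
  part : ZMod 2 → Submodule ℂ V
  isCompl : IsCompl (part 0) (part 1)
  bracket : V →ₗ[ℂ] V →ₗ[ℂ] V
  bracket_mem : ∀ (α β : ZMod 2) (x y : V), x ∈ part α → y ∈ part β → bracket x y ∈ part (α + β)

namespace SuperAlgebra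

section General

variable {V W : Type*} [AddCommGroup V] [Module ℂ V] [AddCommGroup W] [Module ℂ W]

/-- The Leibniz superidentity
`[x, [y, z]] = [[x, y], z] - (-1)^{αβ} [[x, z], y]` for `x ∈ V`, `y ∈ V_α`, `z ∈ V_β`. -/
def IsLeibniz (A : SuperAlgebra V) : Prop :=
  ∀ (α β : ZMod 2) (x y z : V), y ∈ A.part α → z ∈ A.part β →
    A.bracket x (A.bracket y z) =
      A.bracket (A.bracket x y) z - (-1 : ℂ) ^ (α.val * β.val) • A.bracket (A.bracket x z) y

/-- Isomorphism of superalgebras: a bijective linear map that respects the products and the even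
and odd parts. -/
def Isomorphic (A : SuperAlgebra V) (B : SuperAlgebra W) : Prop :=
  ∃ f : V ≃ₗ[ℂ] W,
    (∀ x y, f (A.bracket x y) = B.bracket (f x) (f y)) ∧
    ∀ (α : ZMod 2) (x : V), f x ∈ B.part α ↔ x ∈ A.part α

/-- The span `[I, J]` of all products `[x, y]` with `x ∈ I`, `y ∈ J`. -/
def prod (A : SuperAlgebra V) (I J : Submodule ℂ V) : Submodule ℂ V :=
  Submodule.map₂ A.bracket I J

/-- Lower central series: `I`, `[I, I]`, `[[I, I], I]`, … -/
def lowerSeries (A : SuperAlgebra V) (I : Submodule ℂ V) : ℕ → Submodule ℂ V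
  | 0 => I
  | k + 1 => A.prod (A.lowerSeries I k) I

/-- Derived series: `I`, `[I, I]`, `[[I, I], [I, I]]`, … -/
def derivedSeries (A : SuperAlgebra V) (I : Submodule ℂ V) : ℕ → Submodule ℂ V
  | 0 => I
  | k + 1 => A.prod (A.derivedSeries I k) (A.derivedSeries I k)

/-- The subspace `I` (an ideal or the whole superalgebra, in the uses below) is nilpotent. -/
def NilpotentOn (A : SuperAlgebra V) (I : Submodule ℂ V) : Prop :=
  ∃ k, A.lowerSeries I k = ⊥

/-- The superalgebra is solvable. -/
def Solvable (A : SuperAlgebra V) : Prop :=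
  ∃ k, A.derivedSeries ⊤ k = ⊥

/-- A (two-sided, graded) ideal of a superalgebra. -/
structure IsIdeal (A : SuperAlgebra V) (I : Submodule ℂ V) : Prop where
  graded : I ≤ (I ⊓ A.part 0) ⊔ (I ⊓ A.part 1)
  left_mem : ∀ x y, y ∈ I → A.bracket x y ∈ I
  right_mem : ∀ x y, x ∈ I → A.bracket x y ∈ I

/-- A nilradical: a maximal nilpotent ideal `N` with `[V, V] ⊆ N`. -/
def IsNilradical (A : SuperAlgebra V) (N : Submodule ℂ V) : Prop :=
  Maximal (fun I => A.IsIdeal I ∧ A.NilpotentOn I ∧ A.prod ⊤ ⊤ ≤ I) N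

/-- A superalgebra is split if it is the direct sum of two nonzero ideals. -/
def IsSplit (A : SuperAlgebra V) : Prop :=
  ∃ I J : Submodule ℂ V, A.IsIdeal I ∧ A.IsIdeal J ∧ I ≠ ⊥ ∧ J ≠ ⊥ ∧ IsCompl I J

/-- An ideal `N`, as a superalgebra with the restricted product and grading. -/
def restrict (A : SuperAlgebra V) (N : Submodule ℂ V) (hN : A.IsIdeal N) : SuperAlgebra N where
  part α := (A.part α).comap N.subtype
  isCompl := by
    refine ⟨?_, ?_⟩
    · rw [Submodule.disjoint_def]
      intro x h0 h1
      exact Subtype.ext ((Submodule.disjoint_def.mp A.isCompl.disjoint) x.1 h0 h1)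
    · rw [codisjoint_iff, Submodule.eq_top_iff']
      intro x
      obtain ⟨a, ha, b, hb, hab⟩ := Submodule.mem_sup.mp (hN.graded x.2)
      exact Submodule.mem_sup.mpr ⟨⟨a, ha.1⟩, ha.2, ⟨b, hb.1⟩, hb.2, Subtype.ext hab⟩
  bracket := LinearMap.mk₂ ℂ
    (fun x y => (⟨A.bracket x.1 y.1, hN.right_mem _ _ x.2⟩ : N))
    (fun x x' y => by ext; simp) (fun c x y => by ext; simp)
    (fun x y y' => by ext; simp) (fun c x y => by ext; simp)
  bracket_mem α β x y hx hy := A.bracket_mem α β x.1 y.1 hx hy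

end General

/-! ### Superalgebras given by a multiplication table -/

section Table

variable {ι : Type*} [Fintype ι]

/-- The span of the basis vectors of parity `α`, where `par p` is the parity of the `p`-th one. -/
def tablePart (par : ι → ZMod 2) (α : ZMod 2) : Submodule ℂ (ι → ℂ) where
  carrier := {v | ∀ p, par p ≠ α → v p = 0}
  add_mem' := by
    intro a b ha hb p hp
    simp [ha p hp, hb p hp]
  zero_mem' := by
    intro p _
    rfl
  smul_mem' := by
    intro c a ha p hp
    simp [ha p hp]

/-- The superalgebra on `ℂ^ι` in which the product of the `p`-th and the `q`-th standard basis
vector is `T p q`. -/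
noncomputable def ofTable (par : ι → ZMod 2) (T : ι → ι → ι → ℂ)
    (hT : ∀ p q, T p q ∈ tablePart par (par p + par q)) : SuperAlgebra (ι → ℂ) where
  part := tablePart par
  isCompl := by
    have key : ∀ a : ZMod 2, a = 0 ∨ a = 1 := by decide
    refine ⟨?_, ?_⟩
    · rw [Submodule.disjoint_def]
      intro v h0 h1
      funext p
      rcases key (par p) with h | h
      · exact h1 p (by rw [h]; decide)
      · exact h0 p (by rw [h]; decide)
    · rw [codisjoint_iff, Submodule.eq_top_iff']
      intro v
      refine Submodule.mem_sup.mpr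
        ⟨fun p => if par p = 0 then v p else 0, ?_, fun p => if par p = 0 then 0 else v p, ?_, ?_⟩
      · intro p hp
        simp [hp]
      · intro p hp
        rcases key (par p) with h | h
        · simp [h]
        · exact absurd h hp
      · funext p
        by_cases h : par p = 0 <;> simp [h]
  bracket := (Pi.basisFun ℂ ι).constr ℂ fun p => (Pi.basisFun ℂ ι).constr ℂ (T p)
  bracket_mem := by
    intro α β x y hx hy
    simp only [Module.Basis.constr_apply_fintype, LinearMap.sum_apply, LinearMap.smul_apply]
    refine Submodule.sum_mem _ fun p _ => ?_
    by_cases hp : par p = α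
    · refine Submodule.smul_mem _ _ (Submodule.sum_mem _ fun q _ => ?_)
      by_cases hq : par q = β
      · rw [← hp, ← hq]
        exact Submodule.smul_mem _ _ (hT p q)
      · have : (Pi.basisFun ℂ ι).equivFun y q = 0 := by simpa using hy q hq
        rw [this, zero_smul]
        exact Submodule.zero_mem _
    · have : (Pi.basisFun ℂ ι).equivFun x p = 0 := by simpa using hx p hp
      rw [this, zero_smul]
      exact Submodule.zero_mem _

end Table

/-! ### The family `H` -/

section FamilyH

variable {W : Type*} [AddCommGroup W] [Module ℂ W]

/-- `[e_i, e_j]` in `H(β₄, …, βₙ, δ, γ)`, with `1 ≤ i, j ≤ n`. -/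
noncomputable def hEE (n : ℕ) (β : ℕ → ℂ) (γ : ℂ) (e : ℕ → W) (i j : ℕ) : W :=
  if j = 1 then
    if i = 1 then e 3 else if 3 ≤ i ∧ i ≤ n - 1 then e (i + 1) else 0
  else if j = 2 then
    if i = 1 then ∑ k ∈ Finset.Icc 4 n, β k • e k
    else if i = 2 then γ • e n
    else if i ≤ n - 2 then ∑ k ∈ Finset.Icc 4 (n + 2 - i), β k • e (i + k - 2)
    else 0
  else 0

/-- `[y_i, e_j]` in `H(β₄, …, βₙ, δ, γ)`, with `1 ≤ i, j ≤ n`. -/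
noncomputable def hYE (n : ℕ) (β : ℕ → ℂ) (δ : ℂ) (y : ℕ → W) (i j : ℕ) : W :=
  if j = 1 then
    if i ≤ n - 1 then y (i + 1) else 0
  else if j = 2 then
    if i = 1 then ∑ k ∈ Finset.Icc 4 n, β k • y (k - 1) + δ • y n
    else if i ≤ n - 2 then ∑ k ∈ Finset.Icc 4 (n + 2 - i), β k • y (i + k - 2)
    else 0
  else 0

/-- `[e_i, y_j]` in `H(β₄, …, βₙ, δ, γ)`, with `1 ≤ i, j ≤ n`. -/
noncomputable def hEY (y : ℕ → W) (i j : ℕ) : W :=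
  if j = 1 then
    if i = 1 then (1 / 2 : ℂ) • y 2 else if 3 ≤ i then (1 / 2 : ℂ) • y i else 0
  else 0

/-- `[y_i, y_j]` in `H(β₄, …, βₙ, δ, γ)`, with `1 ≤ i, j ≤ n`. -/
noncomputable def hYY (n : ℕ) (e : ℕ → W) (i j : ℕ) : W :=
  if j = 1 then
    if i = 1 then e 1 else if i ≤ n - 1 then e (i + 1) else 0
  else 0

/-- Indices of the basis `e_1, …, e_n, y_1, …, y_n`: `inl i` stands for `e_{i+1}` and `inr j` for
`y_{j+1}`. -/
abbrev NIdx (n : ℕ) : Type := Fin n ⊕ Fin n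

/-- Multiplication table of `H(β₄, …, βₙ, δ, γ)` on vectors `e_1, …, e_n, y_1, …, y_n`. -/
noncomputable def hTable (n : ℕ) (β : ℕ → ℂ) (δ γ : ℂ) (e y : ℕ → W) : NIdx n → NIdx n → W
  | .inl i, .inl j => hEE n β γ e (i + 1) (j + 1)
  | .inr i, .inl j => hYE n β δ y (i + 1) (j + 1)
  | .inl i, .inr j => hEY y (i + 1) (j + 1)
  | .inr i, .inr j => hYY n e (i + 1) (j + 1)

/-- The `e`'s are even and the `y`'s are odd. -/
def nPar (n : ℕ) : NIdx n → ZMod 2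
  | .inl _ => 0
  | .inr _ => 1

/-- The basis vector `e_k` for `1 ≤ k ≤ n` (and `0` for other `k`). -/
def nE (n k : ℕ) : NIdx n → ℂ
  | .inl i => if i.val + 1 = k then 1 else 0
  | .inr _ => 0

/-- The basis vector `y_k` for `1 ≤ k ≤ n` (and `0` for other `k`). -/
def nY (n k : ℕ) : NIdx n → ℂ
  | .inl _ => 0
  | .inr i => if i.val + 1 = k then 1 else 0

lemma hTable_mem (n : ℕ) (β : ℕ → ℂ) (δ γ : ℂ) (e y : ℕ → W) (S : ZMod 2 → Submodule ℂ W)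
    (he : ∀ k, e k ∈ S 0) (hy : ∀ k, y k ∈ S 1) (p q : NIdx n) :
    hTable n β δ γ e y p q ∈ S (nPar n p + nPar n q) := by
  have he' : ∀ (c : ℂ) k, c • e k ∈ S 0 := fun c k => Submodule.smul_mem _ _ (he k)
  have hy' : ∀ (c : ℂ) k, c • y k ∈ S 1 := fun c k => Submodule.smul_mem _ _ (hy k)
  have h11 : (1 + 1 : ZMod 2) = 0 := by decide
  rcases p with i | i <;> rcases q with j | j <;>
    simp only [hTable, hEE, hYE, hEY, hYY, nPar, add_zero, zero_add, h11] <;>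
    split_ifs <;>
    first
    | exact Submodule.zero_mem _
    | exact he _
    | exact hy _
    | exact he' _ _
    | exact hy' _ _
    | exact Submodule.sum_mem _ fun k _ => he' _ _
    | exact Submodule.sum_mem _ fun k _ => hy' _ _
    | exact Submodule.add_mem _ (Submodule.sum_mem _ fun k _ => hy' _ _) (hy' _ _)

/-- The superalgebra `H(β₄, …, βₙ, δ, γ)`; only the values `β k` with `4 ≤ k ≤ n` are used. -/
noncomputable def familyH (n : ℕ) (β : ℕ → ℂ) (δ γ : ℂ) : SuperAlgebra (NIdx n → ℂ) :=
  ofTable (nPar n) (hTable n β δ γ (nE n) (nY n)) (hTable_mem n β δ γ _ _ _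
    (fun k p hp => by cases p <;> simp_all [nE, nPar])
    (fun k p hp => by cases p <;> simp_all [nY, nPar]))

end FamilyH

/-! ### The superalgebras `SH` -/

/-- Indices of the basis `e_1, …, e_n, y_1, …, y_n, x`. -/
abbrev LIdx (n : ℕ) : Type := NIdx n ⊕ Unit

/-- The `e`'s and `x` are even and the `y`'s are odd. -/
def lPar (n : ℕ) : LIdx n → ZMod 2
  | .inl p => nPar n p
  | .inr _ => 0

/-- The basis vector `e_k` for `1 ≤ k ≤ n` (and `0` for other `k`). -/
def lE (n k : ℕ) : LIdx n → ℂ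
  | .inl p => nE n k p
  | .inr _ => 0

/-- The basis vector `y_k` for `1 ≤ k ≤ n` (and `0` for other `k`). -/
def lY (n k : ℕ) : LIdx n → ℂ
  | .inl p => nY n k p
  | .inr _ => 0

/-- The multiplication table of an extension of `H(β₄, …, βₙ, δ, γ)` by one even vector `x`:
`[e_1, x] = 2 e_1`, `[e_2, x] = b e_2`, `[e_i, x] = 2 (i - 1) e_i` for `3 ≤ i ≤ n`,
`[y_i, x] = (2 i - 1) y_i` for `1 ≤ i ≤ n`,
`[x, e_1] = -2 e_1`, `[x, e_2] = -b e_2 - c e_s`, `[x, y_1] = -y_1`, and all other products with `x`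
are zero. -/
noncomputable def shTable (n : ℕ) (β : ℕ → ℂ) (δ γ b c : ℂ) (s : ℕ) :
    LIdx n → LIdx n → LIdx n → ℂ
  | .inl p, .inl q => hTable n β δ γ (lE n) (lY n) p q
  | .inl (.inl i), .inr _ =>
      if i.val + 1 = 1 then (2 : ℂ) • lE n 1
      else if i.val + 1 = 2 then b • lE n 2
      else (2 * (((i.val + 1 : ℕ) : ℂ) - 1)) • lE n (i.val + 1)
  | .inl (.inr i), .inr _ => (2 * ((i.val + 1 : ℕ) : ℂ) - 1) • lY n (i.val + 1)
  | .inr _, .inl (.inl i) =>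
      if i.val + 1 = 1 then (-2 : ℂ) • lE n 1
      else if i.val + 1 = 2 then (-b) • lE n 2 - c • lE n s
      else 0
  | .inr _, .inl (.inr i) => if i.val + 1 = 1 then - lY n 1 else 0
  | .inr _, .inr _ => 0

lemma shTable_mem (n : ℕ) (β : ℕ → ℂ) (δ γ b c : ℂ) (s : ℕ) (p q : LIdx n) :
    shTable n β δ γ b c s p q ∈ tablePart (lPar n) (lPar n p + lPar n q) := by
  have he : ∀ k, lE n k ∈ tablePart (lPar n) 0 := fun k p hp => by
    rcases p with (i | i) | u <;> simp_all [lE, nE, nPar, lPar]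
  have hy : ∀ k, lY n k ∈ tablePart (lPar n) 1 := fun k p hp => by
    rcases p with (i | i) | u <;> simp_all [lY, nY, nPar, lPar]
  have he' : ∀ (c : ℂ) k, c • lE n k ∈ tablePart (lPar n) 0 :=
    fun c k => Submodule.smul_mem _ _ (he k)
  rcases p with p | u
  · rcases q with q | u
    · exact hTable_mem n β δ γ _ _ _ he hy p q
    · rcases p with i | i <;> simp only [shTable, lPar, nPar, add_zero]
      · split_ifs <;> exact he' _ _
      · exact Submodule.smul_mem _ _ (hy _)
  · rcases q with (i | i) | v <;> simp only [shTable, lPar, nPar, zero_add]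
    · split_ifs
      · exact he' _ _
      · exact Submodule.sub_mem _ (he' _ _) (he' _ _)
      · exact Submodule.zero_mem _
    · split_ifs
      · exact Submodule.neg_mem _ (hy _)
      · exact Submodule.zero_mem _
    · exact Submodule.zero_mem _

/-- The superalgebra with the table `shTable`. -/
noncomputable def shExt (n : ℕ) (β : ℕ → ℂ) (δ γ b c : ℂ) (s : ℕ) : SuperAlgebra (LIdx n → ℂ) :=
  ofTable (lPar n) (shTable n β δ γ b c s) (shTable_mem n β δ γ b c s)

/-- `SH_1(t)`: `β_t = 1` is the only nonzero parameter, `[e_2, x] = 2 (t - 2) e_2` and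
`[x, e_2] = -2 (t - 2) e_2 - 2 e_{t-1}`. -/
noncomputable def SH1 (n t : ℕ) : SuperAlgebra (LIdx n → ℂ) :=
  shExt n (fun k => if k = t then 1 else 0) 0 0 (2 * ((t : ℂ) - 2)) 2 (t - 1)

/-- `SH_2`: `δ = 1` is the only nonzero parameter, `[e_2, x] = 2 (n - 1) e_2` and
`[x, e_2] = -2 (n - 1) e_2 - 2 e_n`. -/
noncomputable def SH2 (n : ℕ) : SuperAlgebra (LIdx n → ℂ) :=
  shExt n (fun _ => 0) 1 0 (2 * ((n : ℂ) - 1)) 2 n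

/-- `SH_3(γ)` for odd `n`: `β_{(n+3)/2} = 1`, the last parameter is `γ`, the others are zero,
`[e_2, x] = (n - 1) e_2` and `[x, e_2] = -(n - 1) e_2 - 2 e_{(n+1)/2}`. -/
noncomputable def SH3 (n : ℕ) (γ : ℂ) : SuperAlgebra (LIdx n → ℂ) :=
  shExt n (fun k => if k = (n + 3) / 2 then 1 else 0) 0 γ ((n : ℂ) - 1) 2 ((n + 1) / 2)

/-- `SH_4`: `γ = 1` is the only nonzero parameter, `[e_2, x] = (n - 1) e_2` and
`[x, e_2] = -(n - 1) e_2`. -/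
noncomputable def SH4 (n : ℕ) : SuperAlgebra (LIdx n → ℂ) :=
  shExt n (fun _ => 0) 0 1 ((n : ℂ) - 1) 0 0

/-- The members of the list: `SH_1(t)` for `4 ≤ t ≤ n`, `SH_2`, `SH_3(γ)` for `γ ≠ 0` and odd `n`
such that `β_{(n+3)/2}` is one of the parameters `β₄, …, βₙ` (that is, `n ≥ 5`), and `SH_4`. -/
inductive SHLabel (n : ℕ) : Type
  | sh1 (t : ℕ) (h4 : 4 ≤ t) (hn : t ≤ n)
  | sh2
  | sh3 (γ : ℂ) (hγ : γ ≠ 0) (hodd : Odd n) (h5 : 5 ≤ n)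
  | sh4

/-- The superalgebra with a given label. -/
noncomputable def SH (n : ℕ) : SHLabel n → SuperAlgebra (LIdx n → ℂ)
  | .sh1 t _ _ => SH1 n t
  | .sh2 => SH2 n
  | .sh3 γ _ _ _ => SH3 n γ
  | .sh4 => SH4 n

end SuperAlgebra

namespace SuperAlgebra

/-! ### Right multiplications in a chain-adapted basis of the nilradical. -/

section Leibniz

variable {V : Type*} [AddCommGroup V] [Module ℂ V] {A : SuperAlgebra V}

/-! Everything is expressed through `R`, the right multiplication by `y_1`. Up to powers of 2 the
vectors `z j = R^j y_1` are `y_1, e_1, y_2, e_3, y_3, e_4, …`, so together with `w = e_2` they form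
a basis of the nilradical `N`. The superidentity gives `R_{z 1} = 2 R^2` and `R_{z j} = 0` for `j ≥
2`, and it makes `R_w` commute with `R`. Hence `R_w` acts on the chain as a polynomial `∑ p_m
R^{2m}` whose coefficients encode the `β_k` and `δ`. The superidentity for `e_2, e_2, y_1` forces `γ
= 0` (`exists_chainModel`), and then non-splitness says that some `p_m` is nonzero
(`exists_chainCoeff_ne_zero`).

An even `q` acts by `[z 0, q] = a z 0 + …`; therefore `[z j, q] = a (j+1) z j + …` and `[w, q] = c
w`, with `p_m (2ma - c) = 0`. If `a = 0`, then `c = 0` too, and right multiplication by `q` raises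
the chain filtration. Odd elements always raise it. The filtration-raising elements form a nilpotent
ideal containing `N`, so by maximality they are `N` (`raising_eq`). The weight `a` then embeds the
quotient by `N` into `ℂ`, and this embedding is nonzero because the superalgebra is not nilpotent
(`finrank_quotient_eq_one`).

Take `x` of weight 1. Correcting `z 0` by higher terms makes it an eigenvector, and the relations
`p_m (2m - c) = 0` leave exactly one nonzero `p_m`, which is normalized by rescaling `w`. A
correction of `x` gives `[x, x] = 0` (`exists_isDiagonal`). The superidentity then determines the
left multiplication by `x` (`x_z0`, `x_z1`, `x_w`). The outcome is `SH1` with `t = m + 2`, or `SH2`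
when `m = n - 1`; the other two members of the list never arise from a Leibniz superalgebra.

Non-isomorphism is proved without the superidentity, since `SH3` and `SH4` violate it. An
isomorphism multiplies the leading term of `y_1` by some `a` and `e_2` by some `b`. Comparing `[y_1,
e_2]` and `[e_2, e_2]` yields the invariants in `ChainFacts.param_eq`. -/

lemma eq_zero_of_mem_both {u : V} (h0 : u ∈ A.part 0) (h1 : u ∈ A.part 1) : u = 0 :=
  Submodule.disjoint_def.mp A.isCompl.disjoint u h0 h1

lemma exists_even_add_odd (A : SuperAlgebra V) (u : V) :
    ∃ a ∈ A.part 0, ∃ b ∈ A.part 1, a + b = u :=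
  Submodule.mem_sup.mp (by rw [A.isCompl.sup_eq_top]; trivial)

lemma IsLeibniz.even_right (hA : A.IsLeibniz) (x : V) {α : ZMod 2} {y z : V} (hy : y ∈ A.part α)
    (hz : z ∈ A.part 0) :
    A.bracket x (A.bracket y z) = A.bracket (A.bracket x y) z - A.bracket (A.bracket x z) y := by
  simpa using hA α 0 x y z hy hz

lemma IsLeibniz.even_left (hA : A.IsLeibniz) (x : V) {α : ZMod 2} {y z : V} (hy : y ∈ A.part 0)
    (hz : z ∈ A.part α) :
    A.bracket x (A.bracket y z) = A.bracket (A.bracket x y) z - A.bracket (A.bracket x z) y := by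
  simpa using hA 0 α x y z hy hz

lemma IsLeibniz.odd_odd (hA : A.IsLeibniz) (x : V) {y z : V} (hy : y ∈ A.part 1)
    (hz : z ∈ A.part 1) :
    A.bracket x (A.bracket y z) = A.bracket (A.bracket x y) z + A.bracket (A.bracket x z) y := by
  have := hA 1 1 x y z hy hz
  simpa [show (1 : ZMod 2).val = 1 from rfl] using this

lemma bracket_even_even {x y : V} (hx : x ∈ A.part 0) (hy : y ∈ A.part 0) :
    A.bracket x y ∈ A.part 0 := by simpa using A.bracket_mem 0 0 x y hx hy

lemma bracket_even_odd {x y : V} (hx : x ∈ A.part 0) (hy : y ∈ A.part 1) :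
    A.bracket x y ∈ A.part 1 := by simpa using A.bracket_mem 0 1 x y hx hy

lemma bracket_odd_even {x y : V} (hx : x ∈ A.part 1) (hy : y ∈ A.part 0) :
    A.bracket x y ∈ A.part 1 := by simpa using A.bracket_mem 1 0 x y hx hy

lemma bracket_odd_odd {x y : V} (hx : x ∈ A.part 1) (hy : y ∈ A.part 1) :
    A.bracket x y ∈ A.part 0 := by
  simpa [show (1 + 1 : ZMod 2) = 0 from rfl] using A.bracket_mem 1 1 x y hx hy

/-- A subspace `N` of a Leibniz superalgebra that contains all products and has a basis
`z 0, …, z (2n - 2), w`, where `z (j + 1) = [z j, z 0]` and the right multiplication by `w` acts on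
`z 0` as a polynomial with coefficients `p` in the square of the right multiplication by `z 0`. -/
structure ChainModel (A : SuperAlgebra V) (n : ℕ) (N : Submodule ℂ V) (z : ℕ → V) (w : V)
    (p : ℕ → ℂ) : Prop where
  leib : A.IsLeibniz
  three_le : 3 ≤ n
  bracket_mem_N : ∀ x y, A.bracket x y ∈ N
  finrank_eq : Module.finrank ℂ N = 2 * n
  z_mem : ∀ j, z j ∈ N
  w_mem : w ∈ N
  z_even : ∀ j, z (2 * j) ∈ A.part 1
  z_odd : ∀ j, z (2 * j + 1) ∈ A.part 0
  w_even : w ∈ A.part 0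
  z_succ : ∀ j, A.bracket (z j) (z 0) = z (j + 1)
  z_top : z (2 * n - 2) ≠ 0
  z_zero : ∀ j, 2 * n - 1 ≤ j → z j = 0
  w_ne : w ≠ 0
  w_z : A.bracket w (z 0) = 0
  z_w : A.bracket (z 0) w = ∑ m ∈ Finset.range n, p m • z (2 * m)
  p_zero : p 0 = 0
  p_one : p 1 = 0
  w_w : A.bracket w w = 0

namespace ChainModel

variable {n : ℕ} {N : Submodule ℂ V} {z : ℕ → V} {w : V} {p : ℕ → ℂ}

lemma z0_odd (h : ChainModel A n N z w p) : z 0 ∈ A.part 1 := h.z_even 0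

lemma z1_even (h : ChainModel A n N z w p) : z 1 ∈ A.part 0 := h.z_odd 0

lemma z_part_of_even (h : ChainModel A n N z w p) {j : ℕ} (hj : Even j) : z j ∈ A.part 1 := by
  obtain ⟨k, rfl⟩ := hj
  rw [← two_mul]; exact h.z_even k

lemma z_part_of_odd (h : ChainModel A n N z w p) {j : ℕ} (hj : Odd j) : z j ∈ A.part 0 := by
  obtain ⟨k, rfl⟩ := hj
  exact h.z_odd k

lemma pow_z (h : ChainModel A n N z w p) (k j : ℕ) :
    (A.bracket.flip (z 0) ^ k) (z j) = z (j + k) := by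
  induction k with
  | zero => simp
  | succ k ih => rw [pow_succ', Module.End.mul_apply, ih]; exact h.z_succ (j + k)

lemma pow_w (h : ChainModel A n N z w p) (k : ℕ) (hk : k ≠ 0) :
    (A.bracket.flip (z 0) ^ k) w = 0 := by
  obtain ⟨k, rfl⟩ := Nat.exists_eq_succ_of_ne_zero hk
  rw [pow_succ, Module.End.mul_apply, LinearMap.flip_apply, h.w_z, map_zero]

/-- The operator `R` is a nilpotent shift on the chain and kills `w`, so powers of `R` isolate the
coefficients one at a time, lowest index first. `R` cannot separate the end of the chain from `w`,
but parity can. -/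
lemma coeff_eq_zero (h : ChainModel A n N z w p) (c : ℕ → ℂ) (d : ℂ)
    (hs : ∑ j ∈ Finset.range (2 * n - 1), c j • z j + d • w = 0) :
    (∀ j < 2 * n - 1, c j = 0) ∧ d = 0 := by
  have h3 := h.three_le
  have hc : ∀ j < 2 * n - 2, c j = 0 := by
    intro j
    induction j using Nat.strong_induction_on with
    | _ j ih =>
    intro hj
    -- This power moves `z j` to the last nonzero vector of the chain: later terms vanish, and
    -- earlier coefficients are zero by induction.
    have := congrArg (A.bracket.flip (z 0) ^ (2 * n - 2 - j)) hs
    rw [map_add, map_sum, map_smul, h.pow_w _ (by omega), smul_zero, add_zero, map_zero,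
      Finset.sum_eq_single j] at this
    · rw [map_smul, h.pow_z, show j + (2 * n - 2 - j) = 2 * n - 2 by omega] at this
      exact (smul_eq_zero.mp this).resolve_right h.z_top
    · intro i _ hij
      rw [map_smul, h.pow_z]
      rcases Nat.lt_or_gt_of_ne hij with hlt | hgt
      · rw [ih i hlt (by omega), zero_smul]
      · rw [h.z_zero _ (by omega), smul_zero]
    · intro hj'
      exact absurd (Finset.mem_range.mpr (by omega)) hj'
  have hs' : c (2 * n - 2) • z (2 * n - 2) + d • w = 0 := by
    rw [← hs, Finset.sum_eq_single (2 * n - 2)]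
    · intro i hi hne
      rw [hc i (by have := Finset.mem_range.mp hi; omega), zero_smul]
    · intro hj'
      exact absurd (Finset.mem_range.mpr (by omega)) hj'
  have hev : Even (2 * n - 2) := ⟨n - 1, by omega⟩
  -- The last chain vector is odd and `w` is even, so each of the two terms is zero separately.
  have h0 : c (2 * n - 2) • z (2 * n - 2) = 0 := by
    refine eq_zero_of_mem_both (A := A) ?_ (Submodule.smul_mem _ _ (h.z_part_of_even hev))
    rw [eq_neg_of_add_eq_zero_left hs']
    exact Submodule.neg_mem _ (Submodule.smul_mem _ _ h.w_even)
  rw [h0, zero_add] at hs'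
  refine ⟨fun j hj => ?_, (smul_eq_zero.mp hs').resolve_right h.w_ne⟩
  rcases Nat.lt_or_ge j (2 * n - 2) with hlt | hge
  · exact hc j hlt
  · rw [show j = 2 * n - 2 by omega]
    exact (smul_eq_zero.mp h0).resolve_right h.z_top

lemma coeff_unique (h : ChainModel A n N z w p) (c c' : ℕ → ℂ)
    (hs : ∑ j ∈ Finset.range (2 * n - 1), c j • z j = ∑ j ∈ Finset.range (2 * n - 1), c' j • z j)
    (j : ℕ) (hj : j < 2 * n - 1) : c j = c' j := by
  have := h.coeff_eq_zero (fun j => c j - c' j) 0 (by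
    simp only [sub_smul, Finset.sum_sub_distrib, hs]; simp)
  exact sub_eq_zero.mp (this.1 j hj)

lemma z_ne (h : ChainModel A n N z w p) {j : ℕ} (hj : j < 2 * n - 1) : z j ≠ 0 := by
  intro h0
  have := (h.coeff_eq_zero (fun i => if i = j then 1 else 0) 0 (by
    simp [ite_smul, Finset.sum_ite_eq', h0])).1 j hj
  simp at this

/-- Independence plus a count: `2n - 1` chain vectors and `w` match the dimension `2n` of `N`. -/
lemma exists_expansion [FiniteDimensional ℂ V] (h : ChainModel A n N z w p) {u : V} (hu : u ∈ N) :
    ∃ (c : ℕ → ℂ) (d : ℂ), u = ∑ j ∈ Finset.range (2 * n - 1), c j • z j + d • w := by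
  let v : Fin (2 * n - 1) ⊕ Unit → N :=
    Sum.elim (fun j => ⟨z j, h.z_mem j⟩) (fun _ => ⟨w, h.w_mem⟩)
  have key : ∀ g : Fin (2 * n - 1) ⊕ Unit → ℂ, ∃ (c : ℕ → ℂ) (d : ℂ),
      (∀ j : Fin (2 * n - 1), g (.inl j) = c j) ∧ g (.inr ()) = d ∧
      ((∑ i, g i • v i : N) : V) = ∑ j ∈ Finset.range (2 * n - 1), c j • z j + d • w := by
    intro g
    refine ⟨fun j => if hj : j < 2 * n - 1 then g (.inl ⟨j, hj⟩) else 0, g (.inr ()),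
      fun j => by simp, rfl, ?_⟩
    rw [Finset.sum_range]
    simp [v, Fintype.sum_sum_type]
  have hli : LinearIndependent ℂ v := by
    rw [Fintype.linearIndependent_iff]
    intro g hg i
    obtain ⟨c, d, h1, h2, h3⟩ := key g
    rw [hg] at h3
    have := h.coeff_eq_zero c d h3.symm
    rcases i with j | _
    · rw [h1]; exact this.1 j j.2
    · rw [h2]; exact this.2
  have hspan := hli.span_eq_top_of_card_eq_finrank (by
    have := h.three_le
    simp [h.finrank_eq]; omega)
  have : (⟨u, hu⟩ : N) ∈ Submodule.span ℂ (Set.range v) := by rw [hspan]; trivial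
  obtain ⟨g, hg⟩ := (Submodule.mem_span_range_iff_exists_fun ℂ).mp this
  obtain ⟨c, d, -, -, h3⟩ := key g
  rw [hg] at h3
  exact ⟨c, d, h3⟩

lemma exists_expansion_even [FiniteDimensional ℂ V] (h : ChainModel A n N z w p) {u : V}
    (hu : u ∈ N) (hu0 : u ∈ A.part 0) :
    ∃ (c : ℕ → ℂ) (d : ℂ), (∀ j, Even j → c j = 0) ∧
      u = ∑ j ∈ Finset.range (2 * n - 1), c j • z j + d • w := by
  obtain ⟨c, d, hcd⟩ := h.exists_expansion hu
  refine ⟨fun j => if Even j then 0 else c j, d, fun j hj => if_pos hj, ?_⟩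
  have hsplit : u = (∑ j ∈ Finset.range (2 * n - 1), (if Even j then 0 else c j) • z j + d • w) +
      ∑ j ∈ Finset.range (2 * n - 1), (if Even j then c j else 0) • z j := by
    rw [hcd, add_right_comm, ← Finset.sum_add_distrib]
    congr 1
    refine Finset.sum_congr rfl fun j _ => ?_
    split_ifs <;> simp
  have ha : (∑ j ∈ Finset.range (2 * n - 1), (if Even j then 0 else c j) • z j + d • w) ∈
      A.part 0 := by
    refine Submodule.add_mem _ (Submodule.sum_mem _ fun j _ => ?_)
      (Submodule.smul_mem _ _ h.w_even)
    split_ifs with hj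
    · simp
    · exact Submodule.smul_mem _ _ (h.z_part_of_odd (Nat.not_even_iff_odd.mp hj))
  have hb : ∑ j ∈ Finset.range (2 * n - 1), (if Even j then c j else 0) • z j ∈ A.part 1 := by
    refine Submodule.sum_mem _ fun j _ => ?_
    split_ifs with hj
    · exact Submodule.smul_mem _ _ (h.z_part_of_even hj)
    · simp
  have h0 := eq_zero_of_mem_both (A := A) (by
    have := Submodule.sub_mem _ hu0 ha
    rwa [hsplit, add_sub_cancel_left] at this) hb
  rw [h0, add_zero] at hsplit
  exact hsplit

lemma exists_expansion_odd [FiniteDimensional ℂ V] (h : ChainModel A n N z w p) {u : V}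
    (hu : u ∈ N) (hu1 : u ∈ A.part 1) :
    ∃ c : ℕ → ℂ, (∀ j, Odd j → c j = 0) ∧
      u = ∑ j ∈ Finset.range (2 * n - 1), c j • z j := by
  obtain ⟨c, d, hcd⟩ := h.exists_expansion hu
  refine ⟨fun j => if Odd j then 0 else c j, fun j hj => if_pos hj, ?_⟩
  have hsplit : u = (∑ j ∈ Finset.range (2 * n - 1), (if Odd j then 0 else c j) • z j) +
      (∑ j ∈ Finset.range (2 * n - 1), (if Odd j then c j else 0) • z j + d • w) := by
    rw [hcd, ← add_assoc, ← Finset.sum_add_distrib]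
    congr 1
    refine Finset.sum_congr rfl fun j _ => ?_
    split_ifs <;> simp
  have hb : (∑ j ∈ Finset.range (2 * n - 1), (if Odd j then c j else 0) • z j + d • w) ∈
      A.part 0 := by
    refine Submodule.add_mem _ (Submodule.sum_mem _ fun j _ => ?_)
      (Submodule.smul_mem _ _ h.w_even)
    split_ifs with hj
    · exact Submodule.smul_mem _ _ (h.z_part_of_odd hj)
    · simp
  have ha : ∑ j ∈ Finset.range (2 * n - 1), (if Odd j then 0 else c j) • z j ∈ A.part 1 := by
    refine Submodule.sum_mem _ fun j _ => ?_
    split_ifs with hj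
    · simp
    · exact Submodule.smul_mem _ _ (h.z_part_of_even (Nat.not_odd_iff_even.mp hj))
  have h0 := eq_zero_of_mem_both (A := A) hb (by
    have := Submodule.sub_mem _ hu1 ha
    rwa [hsplit, add_sub_cancel_left] at this)
  rw [h0, add_zero] at hsplit
  exact hsplit

/-! ### Right multiplications by elements of `N` -/

/-- For two odd entries the superidentity carries a plus sign, so equal entries add up instead of
cancelling. -/
lemma bracket_z_one (h : ChainModel A n N z w p) (u : V) :
    A.bracket u (z 1) = (2 : ℂ) • A.bracket (A.bracket u (z 0)) (z 0) := by
  rw [← h.z_succ 0, h.leib.odd_odd u h.z0_odd h.z0_odd, two_smul]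

/-- The superidentity writes `R_{z 2}` as the commutator of `R` with `R_{z 1} = 2 R^2`, which is
zero. Each later operator is a commutator or anticommutator of the previous one with `R`. -/
lemma bracket_z_of_two_le (h : ChainModel A n N z w p) (u : V) {j : ℕ} (hj : 2 ≤ j) :
    A.bracket u (z j) = 0 := by
  induction j, hj using Nat.le_induction generalizing u with
  | base =>
    rw [← h.z_succ 1, h.leib.even_left u h.z1_even h.z0_odd, h.bracket_z_one, h.bracket_z_one,
      LinearMap.map_smul₂, sub_self]
  | succ j hj ih =>
    rw [← h.z_succ j]
    rcases Nat.even_or_odd j with he | ho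
    · rw [h.leib.odd_odd u (h.z_part_of_even he) h.z0_odd, ih, ih]; simp
    · rw [h.leib.even_left u (h.z_part_of_odd ho) h.z0_odd, ih, ih]; simp

lemma bracket_w_z_one (h : ChainModel A n N z w p) : A.bracket w (z 1) = 0 := by
  rw [h.bracket_z_one, h.w_z]; simp

/-- The difference of the two sides is right multiplication by `[z 0, w]`, which lies in the span of
the `z j` with `j ≥ 2` and so acts by zero. Consequently `R_w` on the whole chain is determined by
its value at `z 0`. -/
lemma bracket_bracket_z_w (h : ChainModel A n N z w p) : ∀ u,
    A.bracket (A.bracket u w) (z 0) = A.bracket (A.bracket u (z 0)) w := by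
  intro u
  have h1 := h.leib.even_right u h.z0_odd h.w_even
  rw [h.z_w, map_sum, Finset.sum_eq_zero] at h1
  · exact (sub_eq_zero.mp h1.symm).symm
  · intro m _
    rcases m with _ | _ | m
    · rw [h.p_zero]; simp
    · rw [h.p_one]; simp
    · rw [map_smul, h.bracket_z_of_two_le u (by omega), smul_zero]

lemma bracket_z_w (h : ChainModel A n N z w p) (j : ℕ) :
    A.bracket (z j) w = ∑ m ∈ Finset.range n, p m • z (j + 2 * m) := by
  induction j with
  | zero => simpa using h.z_w
  | succ j ih =>
    rw [← h.z_succ j, ← h.bracket_bracket_z_w, ih, map_sum, LinearMap.sum_apply]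
    refine Finset.sum_congr rfl fun m _ => ?_
    rw [LinearMap.map_smul₂, h.z_succ, show j + 2 * m + 1 = j + 1 + 2 * m by ring]

lemma bracket_sum_right (h : ChainModel A n N z w p) (u : V) (c : ℕ → ℂ) (d : ℂ) :
    A.bracket u (∑ j ∈ Finset.range (2 * n - 1), c j • z j + d • w) =
      c 0 • A.bracket u (z 0) + c 1 • A.bracket u (z 1) + d • A.bracket u w := by
  have h3 := h.three_le
  rw [map_add, map_sum, map_smul]
  congr 1
  obtain ⟨k, hk⟩ : ∃ k, 2 * n - 1 = k + 2 := ⟨2 * n - 3, by omega⟩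
  rw [hk, Finset.sum_range_succ', Finset.sum_range_succ', Finset.sum_eq_zero]
  · simp only [map_smul, zero_add]; rw [add_comm]
  · intro i _
    rw [map_smul, h.bracket_z_of_two_le u (by omega), smul_zero]

lemma sum_bracket_z0 (h : ChainModel A n N z w p) (c : ℕ → ℂ) (d : ℂ) :
    A.bracket (∑ j ∈ Finset.range (2 * n - 1), c j • z j + d • w) (z 0) =
      ∑ j ∈ Finset.range (2 * n - 1), (if j = 0 then 0 else c (j - 1)) • z j := by
  have h3 := h.three_le
  obtain ⟨k, hk⟩ : ∃ k, 2 * n - 1 = k + 1 := ⟨2 * n - 2, by omega⟩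
  rw [map_add, LinearMap.add_apply, LinearMap.map_smul₂, h.w_z, smul_zero, add_zero, map_sum,
    LinearMap.sum_apply, hk, Finset.sum_range_succ, Finset.sum_range_succ']
  simp only [LinearMap.map_smul₂, h.z_succ]
  rw [h.z_zero (k + 1) (by omega)]
  simp

/-- An even element of `N` annihilated by the right multiplication by `z 0` is a multiple of `w`. -/
lemma eq_smul_w [FiniteDimensional ℂ V] (h : ChainModel A n N z w p) {u : V} (hu : u ∈ N)
    (hu0 : u ∈ A.part 0) (hz : A.bracket u (z 0) = 0) : ∃ d : ℂ, u = d • w := by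
  obtain ⟨c, d, hc, rfl⟩ := h.exists_expansion_even hu hu0
  rw [h.sum_bracket_z0] at hz
  have hcoef := (h.coeff_eq_zero _ 0 (by rw [hz]; simp)).1
  refine ⟨d, ?_⟩
  rw [Finset.sum_eq_zero, zero_add]
  intro j hj
  rcases Nat.even_or_odd j with he | ho
  · rw [hc j he, zero_smul]
  · obtain ⟨i, rfl⟩ := ho
    have := hcoef (2 * i + 1 + 1) (by have := Finset.mem_range.mp hj; omega)
    simp at this
    rw [this, zero_smul]

/-- An odd element of `N` annihilated by the right multiplication by `z 0` is a multiple of the last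
vector of the chain. -/
lemma eq_smul_z_top [FiniteDimensional ℂ V] (h : ChainModel A n N z w p) {u : V} (hu : u ∈ N)
    (hu1 : u ∈ A.part 1) (hz : A.bracket u (z 0) = 0) : ∃ d : ℂ, u = d • z (2 * n - 2) := by
  have h3 := h.three_le
  obtain ⟨c, hc, rfl⟩ := h.exists_expansion_odd hu hu1
  have hz' := h.sum_bracket_z0 c 0
  rw [zero_smul, add_zero, hz] at hz'
  have hcoef := (h.coeff_eq_zero _ 0 (by rw [← hz']; simp)).1
  refine ⟨c (2 * n - 2), ?_⟩
  rw [Finset.sum_eq_single (2 * n - 2)]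
  · intro j hj hne
    have := hcoef (j + 1) (by have := Finset.mem_range.mp hj; omega)
    simp at this
    rw [this, zero_smul]
  · intro hj
    exact absurd (Finset.mem_range.mpr (by omega)) hj

end ChainModel

end Leibniz

/-! ### The chain filtration, weights of even elements, and the codimension of the nilradical. -/

section Filtration

variable {V : Type*} [AddCommGroup V] [Module ℂ V] {A : SuperAlgebra V}

/-- The span of the vectors `z j` with `k ≤ j`, and of `w` if `k ≤ 1`. -/
def chainFiltration (z : ℕ → V) (w : V) (k : ℕ) : Submodule ℂ V :=
  Submodule.span ℂ ({v | ∃ j, k ≤ j ∧ v = z j} ∪ {v | k ≤ 1 ∧ v = w})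

/-- The span of the vectors `z (2 * i)` with `k ≤ i`. -/
def evenTail (z : ℕ → V) (k : ℕ) : Submodule ℂ V :=
  Submodule.span ℂ {v | ∃ i, k ≤ i ∧ v = z (2 * i)}

lemma z_mem_chainFiltration (z : ℕ → V) (w : V) {k j : ℕ} (hkj : k ≤ j) :
    z j ∈ chainFiltration z w k :=
  Submodule.subset_span (Or.inl ⟨j, hkj, rfl⟩)

lemma w_mem_chainFiltration (z : ℕ → V) (w : V) {k : ℕ} (hk : k ≤ 1) :
    w ∈ chainFiltration z w k :=
  Submodule.subset_span (Or.inr ⟨hk, rfl⟩)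

lemma chainFiltration_anti (z : ℕ → V) (w : V) {k l : ℕ} (hkl : k ≤ l) :
    chainFiltration z w l ≤ chainFiltration z w k := by
  refine Submodule.span_mono ?_
  rintro v (⟨j, hj, rfl⟩ | ⟨hl, rfl⟩)
  · exact Or.inl ⟨j, hkl.trans hj, rfl⟩
  · exact Or.inr ⟨hkl.trans hl, rfl⟩

lemma z_mem_evenTail (z : ℕ → V) {k i : ℕ} (hki : k ≤ i) : z (2 * i) ∈ evenTail z k :=
  Submodule.subset_span ⟨i, hki, rfl⟩

lemma evenTail_anti (z : ℕ → V) {k l : ℕ} (hkl : k ≤ l) : evenTail z l ≤ evenTail z k := by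
  refine Submodule.span_mono ?_
  rintro v ⟨j, hj, rfl⟩
  exact ⟨j, hkl.trans hj, rfl⟩

lemma evenTail_le_chainFiltration (z : ℕ → V) (w : V) (k : ℕ) :
    evenTail z k ≤ chainFiltration z w (2 * k) := by
  refine Submodule.span_le.mpr ?_
  rintro v ⟨j, hj, rfl⟩
  exact z_mem_chainFiltration z w (by omega)

lemma exists_sub_smul_mem_evenTail (z : ℕ → V) {k : ℕ} {u : V} (hu : u ∈ evenTail z k) :
    ∃ α : ℂ, u - α • z (2 * k) ∈ evenTail z (k + 1) := by
  induction hu using Submodule.span_induction with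
  | mem v hv =>
    obtain ⟨i, hi, rfl⟩ := hv
    rcases Nat.eq_or_lt_of_le hi with rfl | hlt
    · exact ⟨1, by simp⟩
    · exact ⟨0, by simpa using z_mem_evenTail z hlt⟩
  | zero => exact ⟨0, by simp⟩
  | add x y _ _ hx hy =>
    obtain ⟨a, ha⟩ := hx
    obtain ⟨b, hb⟩ := hy
    refine ⟨a + b, ?_⟩
    have := Submodule.add_mem _ ha hb
    rwa [show x + y - (a + b) • z (2 * k) = x - a • z (2 * k) + (y - b • z (2 * k)) by module]
  | smul c x _ hx =>
    obtain ⟨a, ha⟩ := hx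
    refine ⟨c * a, ?_⟩
    have := Submodule.smul_mem _ c ha
    rwa [show c • x - (c * a) • z (2 * k) = c • (x - a • z (2 * k)) by module]

/-- The elements whose right multiplication shifts the filtration `chainFiltration z w`. -/
def raising (A : SuperAlgebra V) (z : ℕ → V) (w : V) : Submodule ℂ V where
  carrier := {u | (∀ j, A.bracket (z j) u ∈ chainFiltration z w (j + 1)) ∧
    A.bracket w u ∈ chainFiltration z w 2}
  add_mem' := by
    rintro a b ⟨ha, ha'⟩ ⟨hb, hb'⟩
    refine ⟨fun j => ?_, ?_⟩
    · rw [map_add]; exact Submodule.add_mem _ (ha j) (hb j)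
    · rw [map_add]; exact Submodule.add_mem _ ha' hb'
  zero_mem' := by simp
  smul_mem' := by
    rintro c a ⟨ha, ha'⟩
    refine ⟨fun j => ?_, ?_⟩
    · rw [map_smul]; exact Submodule.smul_mem _ _ (ha j)
    · rw [map_smul]; exact Submodule.smul_mem _ _ ha'

lemma bracket_mem_chainFiltration {z : ℕ → V} {w : V} {k : ℕ} {v u : V}
    (hv : v ∈ chainFiltration z w k) (hu : u ∈ raising A z w) :
    A.bracket v u ∈ chainFiltration z w (k + 1) := by
  induction hv using Submodule.span_induction with
  | mem v hv =>
    rcases hv with ⟨j, hj, rfl⟩ | ⟨hk, rfl⟩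
    · exact chainFiltration_anti z w (by omega) (hu.1 j)
    · exact chainFiltration_anti z _ (by omega) hu.2
  | zero => simp
  | add x y _ _ hx hy => rw [map_add]; exact Submodule.add_mem _ hx hy
  | smul c x _ hx => rw [LinearMap.map_smul₂]; exact Submodule.smul_mem _ _ hx

namespace ChainModel

variable {n : ℕ} {N : Submodule ℂ V} {z : ℕ → V} {w : V} {p : ℕ → ℂ}

lemma evenTail_eq_bot (h : ChainModel A n N z w p) : evenTail z n = ⊥ := by
  rw [eq_bot_iff]
  refine Submodule.span_le.mpr ?_
  rintro v ⟨i, hi, rfl⟩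
  exact h.z_zero _ (by omega)

lemma chainFiltration_eq_bot (h : ChainModel A n N z w p) {k : ℕ} (hk : 2 * n - 1 ≤ k) :
    chainFiltration z w k = ⊥ := by
  have h3 := h.three_le
  rw [eq_bot_iff]
  refine Submodule.span_le.mpr ?_
  rintro v (⟨i, hi, rfl⟩ | ⟨h1, -⟩)
  · exact h.z_zero _ (by omega)
  · omega

lemma le_chainFiltration_zero [FiniteDimensional ℂ V] (h : ChainModel A n N z w p) :
    N ≤ chainFiltration z w 0 := by
  intro u hu
  obtain ⟨c, d, rfl⟩ := h.exists_expansion hu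
  exact Submodule.add_mem _
    (Submodule.sum_mem _ fun j _ => Submodule.smul_mem _ _ (z_mem_chainFiltration z w (by omega)))
    (Submodule.smul_mem _ _ (w_mem_chainFiltration z w (by omega)))

lemma bracket_evenTail_right (h : ChainModel A n N z w p) (u : V) {g : V}
    (hg : g ∈ evenTail z 1) : A.bracket u g = 0 := by
  induction hg using Submodule.span_induction with
  | mem v hv =>
    obtain ⟨i, hi, rfl⟩ := hv
    exact h.bracket_z_of_two_le u (by omega)
  | zero => simp
  | add x y _ _ hx hy => rw [map_add, hx, hy, add_zero]
  | smul c x _ hx => rw [map_smul, hx, smul_zero]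

lemma evenTail_le_N (h : ChainModel A n N z w p) (k : ℕ) : evenTail z k ≤ N := by
  refine Submodule.span_le.mpr ?_
  rintro v ⟨i, hi, rfl⟩
  exact h.z_mem _

lemma evenTail_le_part (h : ChainModel A n N z w p) (k : ℕ) : evenTail z k ≤ A.part 1 := by
  refine Submodule.span_le.mpr ?_
  rintro v ⟨i, hi, rfl⟩
  exact h.z_even _

lemma pow_mem_chainFiltration (h : ChainModel A n N z w p) (j : ℕ) {k : ℕ} {v : V}
    (hv : v ∈ chainFiltration z w k) :
    (A.bracket.flip (z 0) ^ j) v ∈ chainFiltration z w (k + j) := by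
  have hz : z 0 ∈ raising A z w := by
    refine ⟨fun j => ?_, ?_⟩
    · rw [h.z_succ]; exact z_mem_chainFiltration z w le_rfl
    · rw [h.w_z]; simp
  induction j with
  | zero => simpa using hv
  | succ j ih =>
    rw [pow_succ', Module.End.mul_apply]
    exact bracket_mem_chainFiltration ih hz

lemma pow_two_mul_mem_evenTail (h : ChainModel A n N z w p) (j : ℕ) {k : ℕ} {v : V}
    (hv : v ∈ evenTail z k) :
    (A.bracket.flip (z 0) ^ (2 * j)) v ∈ evenTail z (k + j) := by
  induction hv using Submodule.span_induction with
  | mem v hv =>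
    obtain ⟨i, hi, rfl⟩ := hv
    rw [h.pow_z, ← mul_add]
    exact z_mem_evenTail z (by omega)
  | zero => simp
  | add x y _ _ hx hy => rw [map_add]; exact Submodule.add_mem _ hx hy
  | smul c x _ hx => rw [map_smul]; exact Submodule.smul_mem _ _ hx

/-- On the tail `R_w` is a polynomial in `R^2`. It therefore transforms correction terms exactly as
it transforms `z 0`, which makes them cancel in `exists_bracket_w_q` and leaves `p` unchanged in
`change_z`. -/
lemma bracket_evenTail_w (h : ChainModel A n N z w p) {k : ℕ} {g : V} (hg : g ∈ evenTail z k) :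
    A.bracket g w = ∑ m ∈ Finset.range n, p m • (A.bracket.flip (z 0) ^ (2 * m)) g := by
  induction hg using Submodule.span_induction with
  | mem v hv =>
    obtain ⟨i, hi, rfl⟩ := hv
    rw [h.bracket_z_w]
    exact Finset.sum_congr rfl fun m _ => by rw [h.pow_z]
  | zero => simp
  | add x y _ _ hx hy =>
    rw [map_add, LinearMap.add_apply, hx, hy, ← Finset.sum_add_distrib]
    exact Finset.sum_congr rfl fun m _ => by rw [map_add, smul_add]
  | smul c x _ hx =>
    rw [LinearMap.map_smul₂, hx, Finset.smul_sum]
    exact Finset.sum_congr rfl fun m _ => by rw [map_smul, smul_comm]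

lemma even_coeff_eq_zero (h : ChainModel A n N z w p) (c : ℕ → ℂ)
    (hs : ∑ m ∈ Finset.range n, c m • z (2 * m) = 0) : ∀ m < n, c m = 0 := by
  intro m hm
  have key : ∑ j ∈ Finset.range (2 * n - 1), (if Even j then c (j / 2) else 0) • z j = 0 := by
    rw [← hs]
    have him : ∑ m ∈ Finset.range n, c m • z (2 * m) =
        ∑ j ∈ (Finset.range n).image (2 * ·), (if Even j then c (j / 2) else 0) • z j := by
      rw [Finset.sum_image (by intro a _ b _ hab; simpa using hab)]
      exact Finset.sum_congr rfl fun i _ => by simp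
    rw [him]
    symm
    refine Finset.sum_subset ?_ ?_
    · intro j hj
      obtain ⟨i, hi, rfl⟩ := Finset.mem_image.mp hj
      have := Finset.mem_range.mp hi
      exact Finset.mem_range.mpr (by omega)
    · intro j hj hj'
      have := Finset.mem_range.mp hj
      rw [if_neg, zero_smul]
      rintro ⟨i, rfl⟩
      exact hj' (Finset.mem_image.mpr ⟨i, Finset.mem_range.mpr (by omega), by ring⟩)
  have := (h.coeff_eq_zero _ 0 (by rw [key]; simp)).1 (2 * m) (by omega)
  simpa using this

/-! ### Right multiplications by even elements -/

/-- The weight `a` is the coefficient of `z 0`; by parity the remaining terms have even index at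
least 2. -/
lemma exists_weight [FiniteDimensional ℂ V] (h : ChainModel A n N z w p) {q : V}
    (hq : q ∈ A.part 0) : ∃ a : ℂ, A.bracket (z 0) q - a • z 0 ∈ evenTail z 1 := by
  have h3 := h.three_le
  obtain ⟨c, hc, hcq⟩ := h.exists_expansion_odd (h.bracket_mem_N (z 0) q)
    (bracket_odd_even h.z0_odd hq)
  refine ⟨c 0, ?_⟩
  obtain ⟨k, hk⟩ : ∃ k, 2 * n - 1 = k + 1 := ⟨2 * n - 2, by omega⟩
  rw [hcq, hk, Finset.sum_range_succ', add_sub_cancel_right]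
  refine Submodule.sum_mem _ fun j _ => ?_
  rcases Nat.even_or_odd (j + 1) with ⟨i, hi⟩ | ho
  · rw [hi, ← two_mul]
    exact Submodule.smul_mem _ _ (z_mem_evenTail z (by omega))
  · rw [hc _ ho, zero_smul]; exact Submodule.zero_mem _

/-- The higher terms of `[z 0, q]` act by zero from the right, so `R_q R - R R_q = a R`. Iterating
this gives the weights `a (j + 1)` along the chain. -/
lemma bracket_z0_q (h : ChainModel A n N z w p) {q : V} (hq : q ∈ A.part 0) {a : ℂ}
    (ha : A.bracket (z 0) q - a • z 0 ∈ evenTail z 1) (u : V) :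
    A.bracket (A.bracket u (z 0)) q = A.bracket (A.bracket u q) (z 0) + a • A.bracket u (z 0) := by
  have h1 := h.leib.even_right u h.z0_odd hq
  have h2 := h.bracket_evenTail_right u ha
  rw [map_sub, map_smul, sub_eq_zero] at h2
  rw [h2] at h1
  rw [h1]; abel

lemma bracket_z_q (h : ChainModel A n N z w p) {q : V} (hq : q ∈ A.part 0) {a : ℂ}
    (ha : A.bracket (z 0) q - a • z 0 ∈ evenTail z 1) (j : ℕ) :
    A.bracket (z j) q = (a * (j + 1)) • z j +
      (A.bracket.flip (z 0) ^ j) (A.bracket (z 0) q - a • z 0) := by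
  induction j with
  | zero => simp
  | succ j ih =>
    rw [← h.z_succ j, h.bracket_z0_q hq ha, ih, pow_succ', Module.End.mul_apply,
      LinearMap.flip_apply, map_add, LinearMap.add_apply, LinearMap.map_smul₂, h.z_succ,
      Nat.cast_add, Nat.cast_one]
    module

/-- `[w, q]` is even and killed by `R`, hence a multiple of `w`. The conditions on `c` come from
comparing coefficients of `z (2m)` in the superidentity for `z 0, w, q`. They tie the weight of `w`
to that of `z 0` and later leave only one nonzero `p m`. -/
lemma exists_bracket_w_q [FiniteDimensional ℂ V] (h : ChainModel A n N z w p) {q : V}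
    (hq : q ∈ A.part 0) {a : ℂ} (ha : A.bracket (z 0) q - a • z 0 ∈ evenTail z 1) :
    ∃ c : ℂ, A.bracket w q = c • w ∧ ∀ m < n, p m * (2 * m * a - c) = 0 := by
  obtain ⟨c, hc⟩ := h.eq_smul_w (h.bracket_mem_N w q) (bracket_even_even h.w_even hq) (by
    have := h.bracket_z0_q hq ha w
    rw [h.w_z] at this
    simpa using this.symm)
  refine ⟨c, hc, ?_⟩
  apply h.even_coeff_eq_zero (fun m => p m * (2 * m * a - c))
  have h1 := h.leib.even_right (z 0) h.w_even hq
  have hzq := h.bracket_z_q hq ha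
  have hz : A.bracket (z 0) q = a • z 0 + (A.bracket (z 0) q - a • z 0) := by abel
  generalize A.bracket (z 0) q - a • z 0 = g at ha hz hzq
  rw [hc, map_smul, hz, map_add, LinearMap.add_apply, h.bracket_evenTail_w ha, LinearMap.map_smul₂,
    h.z_w, map_sum, LinearMap.sum_apply] at h1
  simp only [LinearMap.map_smul₂, hzq, Finset.smul_sum] at h1
  rw [← Finset.sum_add_distrib, ← Finset.sum_sub_distrib, ← sub_eq_zero,
    ← Finset.sum_sub_distrib] at h1
  rw [← neg_eq_zero, ← h1, ← Finset.sum_neg_distrib]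
  refine Finset.sum_congr rfl fun m _ => ?_
  push_cast
  module

/-! ### The elements whose right multiplication shifts the filtration -/

lemma N_le_raising [FiniteDimensional ℂ V] (h : ChainModel A n N z w p) :
    N ≤ raising A z w := by
  have hzero : ∀ u, (∀ v, A.bracket v u = 0) → u ∈ raising A z w := fun u hu =>
    ⟨fun j => by rw [hu]; simp, by rw [hu]; simp⟩
  have hz : ∀ j, z j ∈ raising A z w := by
    intro j
    rcases j with _ | _ | j
    · refine ⟨fun j => ?_, ?_⟩
      · rw [h.z_succ]; exact z_mem_chainFiltration z w le_rfl
      · rw [h.w_z]; simp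
    · refine ⟨fun j => ?_, ?_⟩
      · rw [h.bracket_z_one, h.z_succ, h.z_succ]
        exact Submodule.smul_mem _ _ (z_mem_chainFiltration z w (by omega))
      · rw [h.bracket_w_z_one]; simp
    · exact hzero _ fun v => h.bracket_z_of_two_le v (by omega)
  have hw : w ∈ raising A z w := by
    refine ⟨fun j => ?_, ?_⟩
    · rw [h.bracket_z_w]
      refine Submodule.sum_mem _ fun m _ => ?_
      rcases m with _ | m
      · rw [h.p_zero]; simp
      · exact Submodule.smul_mem _ _ (z_mem_chainFiltration z w (by omega))
    · rw [h.w_w]; simp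
  intro u hu
  obtain ⟨c, d, rfl⟩ := h.exists_expansion hu
  exact Submodule.add_mem _ (Submodule.sum_mem _ fun j _ => Submodule.smul_mem _ _ (hz j))
    (Submodule.smul_mem _ _ hw)

/-- Weight zero on `z 0` kills the diagonal part on the whole chain. A nonzero `p m` is what forces
weight zero on `w` as well; otherwise `w` could be a separate eigenvector and the codimension could
grow. -/
lemma even_mem_raising [FiniteDimensional ℂ V] (h : ChainModel A n N z w p)
    (hp : ∃ m < n, p m ≠ 0) {q : V} (hq : q ∈ A.part 0)
    (hq0 : A.bracket (z 0) q ∈ evenTail z 1) : q ∈ raising A z w := by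
  have ha : A.bracket (z 0) q - (0 : ℂ) • z 0 ∈ evenTail z 1 := by simpa using hq0
  obtain ⟨c, hc, hpc⟩ := h.exists_bracket_w_q hq ha
  obtain ⟨m, hm, hpm⟩ := hp
  have hc0 : c = 0 := by
    have := (mul_eq_zero.mp (hpc m hm)).resolve_left hpm
    simpa using this
  refine ⟨fun j => ?_, ?_⟩
  · rw [h.bracket_z_q hq ha, zero_mul, zero_smul, zero_add]
    exact chainFiltration_anti z w (by omega)
      (h.pow_mem_chainFiltration j (evenTail_le_chainFiltration z w 1 ha))
  · rw [hc, hc0]; simp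

/-- Since `[z 0, q]` is even it has no `z 0` term, though it may contain `w`; this is why `w` is
placed in level 1 of the filtration. The superidentity for `z 0, q` expresses `R_q R` through `-R
R_q`, `R^2` and `R_w`, and this propagates the shift along the chain. -/
lemma odd_mem_raising [FiniteDimensional ℂ V] (h : ChainModel A n N z w p) {q : V}
    (hq : q ∈ A.part 1) : q ∈ raising A z w := by
  have h3 := h.three_le
  obtain ⟨c, d, hc, hcq⟩ := h.exists_expansion_even (h.bracket_mem_N (z 0) q)
    (bracket_odd_odd h.z0_odd hq)
  have hR : ∀ u, A.bracket (A.bracket u (z 0)) q =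
      c 1 • A.bracket u (z 1) + d • A.bracket u w - A.bracket (A.bracket u q) (z 0) := by
    intro u
    have h1 := h.leib.odd_odd u h.z0_odd hq
    rw [hcq, h.bracket_sum_right, hc 0 (by simp)] at h1
    rw [zero_smul, zero_add] at h1
    rw [h1]; abel
  have hz0 : z 0 ∈ raising A z w := h.N_le_raising (h.z_mem 0)
  refine ⟨fun j => ?_, ?_⟩
  · induction j with
    | zero =>
      rw [hcq]
      refine Submodule.add_mem _ (Submodule.sum_mem _ fun j _ => ?_)
        (Submodule.smul_mem _ _ (w_mem_chainFiltration z w le_rfl))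
      rcases j with _ | j
      · rw [hc 0 (by simp)]; simp
      · exact Submodule.smul_mem _ _ (z_mem_chainFiltration z w (by omega))
    | succ j ih =>
      rw [← h.z_succ j, hR]
      refine Submodule.sub_mem _ (Submodule.add_mem _ (Submodule.smul_mem _ _ ?_)
        (Submodule.smul_mem _ _ ?_)) (bracket_mem_chainFiltration ih hz0)
      · rw [h.bracket_z_one, h.z_succ, h.z_succ]
        exact Submodule.smul_mem _ _ (z_mem_chainFiltration z w (by omega))
      · rw [h.bracket_z_w]
        refine Submodule.sum_mem _ fun m _ => ?_
        rcases m with _ | m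
        · rw [h.p_zero]; simp
        · exact Submodule.smul_mem _ _ (z_mem_chainFiltration z w (by omega))
  · have h1 := hR w
    rw [h.w_z, h.bracket_w_z_one, h.w_w, smul_zero, smul_zero, add_zero, zero_sub, map_zero,
      LinearMap.zero_apply, eq_comm, neg_eq_zero] at h1
    obtain ⟨e, he⟩ := h.eq_smul_z_top (h.bracket_mem_N w q) (bracket_even_odd h.w_even hq) h1
    rw [he]
    exact Submodule.smul_mem _ _ (z_mem_chainFiltration z w (by omega))

/-- All products lie in `N`, which is contained in `raising`, so only gradedness needs an argument;
it holds because every odd element is raising. -/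
lemma isIdeal_raising [FiniteDimensional ℂ V] (h : ChainModel A n N z w p) :
    A.IsIdeal (raising A z w) where
  graded u hu := by
    obtain ⟨a, ha, b, hb, rfl⟩ := A.exists_even_add_odd u
    have hb' := h.odd_mem_raising hb
    have ha' : a ∈ raising A z w := by simpa using Submodule.sub_mem _ hu hb'
    exact Submodule.add_mem_sup ⟨ha', ha⟩ ⟨hb', hb⟩
  left_mem x y _ := h.N_le_raising (h.bracket_mem_N x y)
  right_mem x y _ := h.N_le_raising (h.bracket_mem_N x y)

lemma nilpotentOn_raising [FiniteDimensional ℂ V] (h : ChainModel A n N z w p) :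
    A.NilpotentOn (raising A z w) := by
  -- The index is shifted by one because the filtration spans only `N`, which is reached after the
  -- first product.
  have key : ∀ k, A.lowerSeries (raising A z w) (k + 1) ≤ chainFiltration z w k := by
    intro k
    induction k with
    | zero =>
      refine Submodule.map₂_le.mpr fun x _ y _ => ?_
      exact h.le_chainFiltration_zero (h.bracket_mem_N x y)
    | succ k ih =>
      refine Submodule.map₂_le.mpr fun x hx y hy => ?_
      exact bracket_mem_chainFiltration (ih hx) hy
  exact ⟨2 * n - 1 + 1, eq_bot_iff.mpr ((key _).trans (h.chainFiltration_eq_bot le_rfl).le)⟩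

lemma raising_eq [FiniteDimensional ℂ V] (h : ChainModel A n N z w p) (hN : A.IsNilradical N) :
    raising A z w = N := by
  refine le_antisymm (hN.2 ⟨h.isIdeal_raising, h.nilpotentOn_raising, ?_⟩ h.N_le_raising)
    h.N_le_raising
  exact Submodule.map₂_le.mpr fun x _ y _ => h.N_le_raising (h.bracket_mem_N x y)

/-- The nilradical has codimension one, and a complement of it is spanned by an even element whose
right multiplication has `z 0` as an eigenvector of weight one, up to higher terms. -/
lemma finrank_quotient_eq_one [FiniteDimensional ℂ V] (h : ChainModel A n N z w p)
    (hN : A.IsNilradical N) (hnil : ¬ A.NilpotentOn ⊤) (hp : ∃ m < n, p m ≠ 0) :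
    Module.finrank ℂ (V ⧸ N) = 1 ∧
      ∃ x ∈ A.part 0, x ∉ N ∧ A.bracket (z 0) x - (1 : ℂ) • z 0 ∈ evenTail z 1 := by
  have hodd : ∀ q ∈ A.part 1, q ∈ N := fun q hq => by
    rw [← h.raising_eq hN]; exact h.odd_mem_raising hq
  have heven : ∀ q ∈ A.part 0, A.bracket (z 0) q ∈ evenTail z 1 → q ∈ N := fun q hq hq0 => by
    rw [← h.raising_eq hN]; exact h.even_mem_raising hp hq hq0
  obtain ⟨x, hx0, hxN⟩ : ∃ x ∈ A.part 0, x ∉ N := by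
    by_contra! hcon
    refine hnil ?_
    have htop : N = ⊤ := by
      rw [Submodule.eq_top_iff']
      intro u
      obtain ⟨a, ha, b, hb, rfl⟩ := A.exists_even_add_odd u
      exact Submodule.add_mem _ (hcon a ha) (hodd b hb)
    rw [← htop]
    exact hN.1.2.1
  obtain ⟨a, ha⟩ := h.exists_weight hx0
  have ha0 : a ≠ 0 := by
    rintro rfl
    exact hxN (heven x hx0 (by simpa using ha))
  refine ⟨?_, a⁻¹ • x, Submodule.smul_mem _ _ hx0, ?_, ?_⟩
  · rw [finrank_eq_one_iff_of_nonzero' (N.mkQ x) (by simpa using hxN)]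
    intro v
    obtain ⟨u, rfl⟩ := N.mkQ_surjective v
    obtain ⟨q, hq, r, hr, rfl⟩ := A.exists_even_add_odd u
    obtain ⟨b, hb⟩ := h.exists_weight hq
    -- Subtracting this multiple of `x` cancels the weight of `q`, so the remainder is raising and
    -- lies in `N`.
    refine ⟨b / a, ?_⟩
    rw [← map_smul, ← sub_eq_zero, ← map_sub, Submodule.mkQ_apply, Submodule.Quotient.mk_eq_zero]
    rw [show (b / a) • x - (q + r) = -(q - (b / a) • x) - r by module]
    refine Submodule.sub_mem _ (Submodule.neg_mem _ (heven _ ?_ ?_)) (hodd r hr)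
    · exact Submodule.sub_mem _ hq (Submodule.smul_mem _ _ hx0)
    · have := Submodule.sub_mem _ hb (Submodule.smul_mem _ (b / a) ha)
      rw [map_sub, map_smul]
      convert this using 1
      rw [smul_sub, smul_smul, div_mul_cancel₀ _ ha0]
      abel
  · intro hmem
    refine hxN ?_
    have := Submodule.smul_mem _ a hmem
    rwa [smul_smul, mul_inv_cancel₀ ha0, one_smul] at this
  · have := Submodule.smul_mem _ a⁻¹ ha
    rwa [smul_sub, smul_smul, inv_mul_cancel₀ ha0, ← map_smul] at this

/-! ### Diagonalization -/

/-- The diagonal entries `1, 3, 5, …` of right multiplication by `x` on `z 0, z 2, z 4, …` are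
distinct, so the error can be removed one degree at a time until the chain ends. -/
lemma exists_eigenvector (h : ChainModel A n N z w p) {x : V} (hx : x ∈ A.part 0)
    (ha : A.bracket (z 0) x - (1 : ℂ) • z 0 ∈ evenTail z 1) :
    ∃ v ∈ evenTail z 1, A.bracket (z 0 + v) x = z 0 + v := by
  have key : ∀ k, ∃ v ∈ evenTail z 1,
      A.bracket (z 0 + v) x - (z 0 + v) ∈ evenTail z (k + 1) := by
    intro k
    induction k with
    | zero => exact ⟨0, Submodule.zero_mem _, by simpa using ha⟩
    | succ k ih =>
      obtain ⟨v, hv, hk⟩ := ih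
      obtain ⟨α, hα⟩ := exists_sub_smul_mem_evenTail z hk
      -- The divisor is the gap between the weight `2k + 3` of `z (2(k+1))` and the target weight 1.
      refine ⟨v - (α / (2 * (k + 1))) • z (2 * (k + 1)),
        Submodule.sub_mem _ hv (Submodule.smul_mem _ _ (z_mem_evenTail z (by omega))), ?_⟩
      have h1 := h.pow_two_mul_mem_evenTail (k + 1) ha
      have h2 := Submodule.sub_mem _ hα (Submodule.smul_mem _ (α / (2 * (k + 1)))
        (evenTail_anti z (show k + 1 + 1 ≤ 1 + (k + 1) by omega) h1))
      convert h2 using 1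
      have hk0 : (k + 1 : ℂ) ≠ 0 := Nat.cast_add_one_ne_zero k
      have hz := h.bracket_z_q hx ha (2 * (k + 1))
      rw [← add_sub_assoc, map_sub, LinearMap.sub_apply, LinearMap.map_smul₂, hz]
      push_cast
      rw [show α • z (2 * (k + 1)) =
        ((α / (2 * (k + 1))) * (2 * (k + 1))) • z (2 * (k + 1)) by
          rw [div_mul_cancel₀]; simpa using hk0]
      module
  obtain ⟨v, hv, hvn⟩ := key n
  have hbot := evenTail_anti z (Nat.le_succ n) hvn
  rw [h.evenTail_eq_bot, Submodule.mem_bot, sub_eq_zero] at hbot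
  exact ⟨v, hv, hbot⟩

/-- Replacing the initial vector of the chain by one with the same leading term. -/
lemma change_z (h : ChainModel A n N z w p) {v : V} (hv : v ∈ evenTail z 1) :
    ChainModel A n N (fun j => (A.bracket.flip (z 0) ^ j) (z 0 + v)) w p := by
  have h3 := h.three_le
  have hsucc : ∀ j, (A.bracket.flip (z 0) ^ (j + 1)) (z 0 + v) =
      A.bracket ((A.bracket.flip (z 0) ^ j) (z 0 + v)) (z 0) := fun j => by
    rw [pow_succ', Module.End.mul_apply, LinearMap.flip_apply]
  have h0 : z 0 + v ∈ A.part 1 := Submodule.add_mem _ h.z0_odd (h.evenTail_le_part 1 hv)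
  have hev : ∀ j, (A.bracket.flip (z 0) ^ (2 * j)) (z 0 + v) ∈ A.part 1 := by
    intro j
    induction j with
    | zero => simpa using h0
    | succ j ih =>
      rw [show 2 * (j + 1) = 2 * j + 1 + 1 by ring, hsucc, hsucc]
      exact bracket_even_odd (bracket_odd_odd ih h.z0_odd) h.z0_odd
  have hpow : ∀ j, 2 * n - 2 ≤ j → (A.bracket.flip (z 0) ^ j) v = 0 := by
    intro j hj
    have := h.pow_mem_chainFiltration j (evenTail_le_chainFiltration z w 1 hv)
    rwa [h.chainFiltration_eq_bot (by omega), Submodule.mem_bot] at this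
  refine
    { leib := h.leib
      three_le := h3
      bracket_mem_N := h.bracket_mem_N
      finrank_eq := h.finrank_eq
      z_mem := ?_
      w_mem := h.w_mem
      z_even := hev
      z_odd := fun j => by rw [hsucc]; exact bracket_odd_odd (hev j) h.z0_odd
      w_even := h.w_even
      z_succ := ?_
      z_top := ?_
      z_zero := ?_
      w_ne := h.w_ne
      w_z := ?_
      z_w := ?_
      p_zero := h.p_zero
      p_one := h.p_one
      w_w := h.w_w }
  · intro j
    rcases j with _ | j
    · exact Submodule.add_mem _ (h.z_mem 0) (h.evenTail_le_N 1 hv)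
    · rw [hsucc]; exact h.bracket_mem_N _ _
  · intro j
    rw [hsucc]
    simp only [pow_zero, Module.End.one_apply]
    -- Right multiplication by `z 0 + v` is still `R`, so the new chain is generated by the old
    -- operator.
    rw [map_add, h.bracket_evenTail_right _ hv, add_zero]
  · rw [map_add, hpow _ le_rfl, add_zero, h.pow_z, zero_add]
    exact h.z_top
  · intro j hj
    rw [map_add, hpow _ (by omega), add_zero, h.pow_z, zero_add]
    exact h.z_zero j hj
  · simp only [pow_zero, Module.End.one_apply]
    rw [map_add, h.w_z, h.bracket_evenTail_right _ hv, add_zero]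
  · simp only [pow_zero, Module.End.one_apply]
    rw [map_add, LinearMap.add_apply, h.z_w, h.bracket_evenTail_w hv, ← Finset.sum_add_distrib]
    refine Finset.sum_congr rfl fun m _ => ?_
    rw [map_add, h.pow_z, zero_add, smul_add]

end ChainModel

end Filtration

/-! ### Normalizing the basis and determining the action of the complement. -/

section StandardForm

variable {V W : Type*} [AddCommGroup V] [Module ℂ V] [AddCommGroup W] [Module ℂ W]
  {A : SuperAlgebra V}

namespace ChainModel

variable {n : ℕ} {N : Submodule ℂ V} {z : ℕ → V} {w : V} {p : ℕ → ℂ}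

/-- Rescaling the vector `w`. -/
lemma change_w (h : ChainModel A n N z w p) {s : ℂ} (hs : s ≠ 0) {p' : ℕ → ℂ}
    (hp' : ∀ k < n, p' k = s * p k) : ChainModel A n N z (s • w) p' where
  leib := h.leib
  three_le := h.three_le
  bracket_mem_N := h.bracket_mem_N
  finrank_eq := h.finrank_eq
  z_mem := h.z_mem
  w_mem := Submodule.smul_mem _ _ h.w_mem
  z_even := h.z_even
  z_odd := h.z_odd
  w_even := Submodule.smul_mem _ _ h.w_even
  z_succ := h.z_succ
  z_top := h.z_top
  z_zero := h.z_zero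
  w_ne := smul_ne_zero hs h.w_ne
  w_z := by rw [LinearMap.map_smul₂, h.w_z, smul_zero]
  z_w := by
    rw [map_smul, h.z_w, Finset.smul_sum]
    exact Finset.sum_congr rfl fun k hk => by rw [hp' k (Finset.mem_range.mp hk), smul_smul]
  p_zero := by rw [hp' 0 (by have := h.three_le; omega), h.p_zero, mul_zero]
  p_one := by rw [hp' 1 (by have := h.three_le; omega), h.p_one, mul_zero]
  w_w := by rw [map_smul, LinearMap.map_smul₂, h.w_w]; simp

/-- The nilradical is spanned by `z 0, z 1, …` and `w`, and an even vector `x` outside it acts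
diagonally from the right. -/
structure IsDiagonal (A : SuperAlgebra V) (n m : ℕ) (N : Submodule ℂ V) (z : ℕ → V) (w x : V) :
    Prop where
  chain : ChainModel A n N z w fun k => if k = m then 2 ^ m else 0
  two_le : 2 ≤ m
  lt : m < n
  x_even : x ∈ A.part 0
  x_notMem : x ∉ N
  z_x : ∀ j, A.bracket (z j) x = (j + 1 : ℂ) • z j
  w_x : A.bracket w x = (2 * m : ℂ) • w
  x_x : A.bracket x x = 0

/-- The condition `p k (2k - c) = 0` leaves only the index with `2k = c`. The factor `2 ^ m` is
chosen because `2 ^ m z (2m)` is `y_{m+1}`, so the surviving parameter of the table becomes 1. -/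
lemma exists_isDiagonal [FiniteDimensional ℂ V] (h : ChainModel A n N z w p)
    (hp : ∃ m < n, p m ≠ 0) {x : V} (hx : x ∈ A.part 0) (hxN : x ∉ N)
    (ha : A.bracket (z 0) x - (1 : ℂ) • z 0 ∈ evenTail z 1) :
    ∃ (m : ℕ) (z' : ℕ → V) (w' x' : V), IsDiagonal A n m N z' w' x' := by
  obtain ⟨v, hv, hvx⟩ := h.exists_eigenvector hx ha
  replace h := h.change_z hv
  have hz0 : (A.bracket.flip (z 0) ^ 0) (z 0 + v) = z 0 + v := by simp
  generalize hz' : (fun j => (A.bracket.flip (z 0) ^ j) (z 0 + v)) = z' at h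
  have hz'0 : A.bracket (z' 0) x - (1 : ℂ) • z' 0 = 0 := by
    rw [← hz']; simp only [hz0, hvx]; simp
  clear hvx hv ha hz' hz0
  have ha : A.bracket (z' 0) x - (1 : ℂ) • z' 0 ∈ evenTail z' 1 := by
    rw [hz'0]; exact Submodule.zero_mem _
  have hzx : ∀ j, A.bracket (z' j) x = (j + 1 : ℂ) • z' j := fun j => by
    rw [h.bracket_z_q hx ha, hz'0, map_zero, add_zero, one_mul]
  obtain ⟨c, hwx, hc⟩ := h.exists_bracket_w_q hx ha
  obtain ⟨m, hmn, hpm⟩ := hp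
  have hcm : c = 2 * m := by
    have := (mul_eq_zero.mp (hc m hmn)).resolve_left hpm
    rw [mul_one, sub_eq_zero] at this
    exact this.symm
  have hpk : ∀ k < n, k ≠ m → p k = 0 := by
    intro k hk hkm
    refine (mul_eq_zero.mp (hc k hk)).resolve_right ?_
    rw [hcm, mul_one, sub_eq_zero]
    intro heq
    exact hkm (by exact_mod_cast mul_left_cancel₀ two_ne_zero heq)
  have hm2 : 2 ≤ m := by
    by_contra! hlt
    interval_cases m
    · exact hpm h.p_zero
    · exact hpm h.p_one
  have h2m : (2 : ℂ) ^ m / p m ≠ 0 := div_ne_zero (pow_ne_zero _ two_ne_zero) hpm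
  have h' := h.change_w h2m (p' := fun k => if k = m then 2 ^ m else 0) (by
    intro k hk
    rcases eq_or_ne k m with rfl | hkm
    · rw [if_pos rfl, div_mul_cancel₀ _ hpm]
    · rw [if_neg hkm, hpk k hk hkm, mul_zero])
  have hwx' : A.bracket ((2 ^ m / p m : ℂ) • w) x = (2 * m : ℂ) • (2 ^ m / p m : ℂ) • w := by
    rw [LinearMap.map_smul₂, hwx, hcm, smul_comm]
  generalize (2 ^ m / p m : ℂ) • w = w' at h' hwx'
  clear h hwx
  obtain ⟨d, e, hd, hde⟩ := h'.exists_expansion_even (h'.bracket_mem_N x x)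
    (bracket_even_even hx hx)
  have hxx : A.bracket (z' 0) (A.bracket x x) = 0 := by
    rw [h'.leib.even_right (z' 0) hx hx, sub_self]
  have h3 := h'.three_le
  -- Right multiplication by `[x, x]` is zero, while its value at `z 0` is `2 d_1 z 2 + e 2^m z
  -- (2m)`. These vectors are independent because `m ≥ 2`.
  have hd1 : d 1 = 0 ∧ e = 0 := by
    rw [hde, h'.bracket_sum_right, hd 0 (by simp), h'.bracket_z_one, h'.z_succ, h'.z_succ,
      h'.z_w] at hxx
    have := h'.even_coeff_eq_zero (fun k => if k = 1 then 2 * d 1 else if k = m then e * 2 ^ m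
      else 0) (by
        rw [← hxx, zero_smul, zero_add, Finset.smul_sum]
        have h1 : d 1 • (2 : ℂ) • z' (0 + 1 + 1) = ∑ k ∈ Finset.range n,
            (if k = 1 then d 1 * 2 else 0 : ℂ) • z' (2 * k) := by
          rw [Finset.sum_eq_single 1]
          · simp [smul_smul]
          · intro b _ hb; simp [hb]
          · intro hb; exact absurd (Finset.mem_range.mpr (by omega)) hb
        rw [h1, ← Finset.sum_add_distrib]
        refine Finset.sum_congr rfl fun k _ => ?_
        rcases eq_or_ne k 1 with rfl | hk1
        · rw [if_pos rfl, if_pos rfl, if_neg (by omega)]; module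
        · rw [if_neg hk1, if_neg hk1]; split_ifs <;> module)
    have t1 := this 1 (by omega)
    have t2 := this m hmn
    simp only [if_true] at t1
    rw [if_neg (by omega), if_pos rfl] at t2
    exact ⟨by simpa using t1, by simpa using t2⟩
  -- Dividing by the weight `j + 1` of `z' j` solves `[u, x] = [x, x]`. As `u` acts by zero from the
  -- right, replacing `x` by `x - u` kills the square and leaves the right action of `x` intact.
  let u := ∑ j ∈ Finset.range (2 * n - 1), (d j / (j + 1)) • z' j
  have hu0 : ∀ v, A.bracket v u = 0 := fun v => by
    have := h'.bracket_sum_right v (fun j => d j / (j + 1)) 0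
    rw [zero_smul, add_zero] at this
    rw [this, hd 0 (by simp), hd1.1]; simp
  have hux : A.bracket u x = A.bracket x x := by
    rw [hde, hd1.2, zero_smul, add_zero]
    simp only [u, map_sum, LinearMap.sum_apply, LinearMap.map_smul₂, hzx]
    refine Finset.sum_congr rfl fun j _ => ?_
    rw [smul_smul, div_mul_cancel₀ _ (Nat.cast_add_one_ne_zero j)]
  have huN : u ∈ N := Submodule.sum_mem _ fun j _ => Submodule.smul_mem _ _ (h'.z_mem j)
  have hu_even : u ∈ A.part 0 := by
    refine Submodule.sum_mem _ fun j _ => ?_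
    rcases Nat.even_or_odd j with he | ho
    · rw [hd j he]; simp
    · exact Submodule.smul_mem _ _ (h'.z_part_of_odd ho)
  refine ⟨m, z', w', x - u,
    { chain := h'
      two_le := hm2
      lt := hmn
      x_even := Submodule.sub_mem _ hx hu_even
      x_notMem := fun hmem => hxN (by simpa using Submodule.add_mem _ hmem huN)
      z_x := fun j => by rw [map_sub, hu0, sub_zero, hzx]
      w_x := by rw [map_sub, hu0, sub_zero, hwx']
      x_x := by rw [map_sub, hu0, sub_zero, map_sub, LinearMap.sub_apply, hux, sub_self] }⟩

namespace IsDiagonal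

variable {m : ℕ} {x : V}

lemma z_w (h : IsDiagonal A n m N z w x) (j : ℕ) :
    A.bracket (z j) w = (2 ^ m : ℂ) • z (j + 2 * m) := by
  rw [h.chain.bracket_z_w, Finset.sum_eq_single m]
  · rw [if_pos rfl]
  · intro k _ hk; rw [if_neg hk, zero_smul]
  · intro hm; exact absurd (Finset.mem_range.mpr h.lt) hm

lemma sum_x (h : IsDiagonal A n m N z w x) (c : ℕ → ℂ) :
    A.bracket (∑ j ∈ Finset.range (2 * n - 1), c j • z j) x =
      ∑ j ∈ Finset.range (2 * n - 1), ((j + 1) * c j) • z j := by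
  rw [map_sum, LinearMap.sum_apply]
  refine Finset.sum_congr rfl fun j _ => ?_
  rw [LinearMap.map_smul₂, h.z_x, smul_smul, mul_comm]

/-- The superidentity for `x, z 0, x` makes `[x, z 0]` an eigenvector of weight 1, hence a multiple
of `z 0`. The one for `z 0, x, z 0` fixes the factor through `z 1 - 2 z 1 = -z 1`. -/
lemma x_z0 [FiniteDimensional ℂ V] (h : IsDiagonal A n m N z w x) :
    A.bracket x (z 0) = - z 0 := by
  have h3 := h.chain.three_le
  obtain ⟨c, -, hcr⟩ := h.chain.exists_expansion_odd (h.chain.bracket_mem_N x (z 0))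
    (bracket_even_odd h.x_even h.chain.z0_odd)
  have h1 := h.chain.leib.even_right x h.chain.z0_odd h.x_even
  rw [h.x_x, h.z_x, hcr, h.sum_x] at h1
  have hr : A.bracket x (z 0) = c 0 • z 0 := by
    have hc := h.chain.coeff_unique c (fun j => (j + 1) * c j) (by
      rw [← hcr]
      simpa using h1)
    rw [hcr, Finset.sum_eq_single 0]
    · intro j hj hj0
      have := hc j (Finset.mem_range.mp hj)
      have : (j : ℂ) * c j = 0 := by linear_combination -this
      rw [(mul_eq_zero.mp this).resolve_left (by exact_mod_cast hj0), zero_smul]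
    · intro h0; exact absurd (Finset.mem_range.mpr (by omega)) h0
  have h2 := h.chain.leib.even_left (z 0) h.x_even h.chain.z0_odd
  rw [hr, map_smul, h.chain.z_succ, h.z_x, h.z_x, LinearMap.map_smul₂, h.chain.z_succ,
    ← sub_eq_zero] at h2
  have h4 : (c 0 + 1) • z (0 + 1) = 0 := by
    rw [← h2]; push_cast; module
  have h5 := (smul_eq_zero.mp h4).resolve_right (h.chain.z_ne (by omega))
  rw [hr, eq_neg_of_add_eq_zero_left h5, neg_one_smul]

lemma x_z1 [FiniteDimensional ℂ V] (h : IsDiagonal A n m N z w x) :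
    A.bracket x (z 1) = (-2 : ℂ) • z 1 := by
  rw [h.chain.bracket_z_one, h.x_z0, LinearMap.map_neg₂, h.chain.z_succ]
  module

/-- `[x, w]` has weight `2m`, which is shared only by `w` and `z (2m - 1)`. The superidentity for `z
0, x, w` gives the first coefficient; commutation of `R` and `R_w`, applied to `x`, gives the
second. -/
lemma x_w [FiniteDimensional ℂ V] (h : IsDiagonal A n m N z w x) :
    A.bracket x w = -(2 * m : ℂ) • w - (2 ^ m : ℂ) • z (2 * m - 1) := by
  have h3 := h.chain.three_le
  have hm := h.two_le
  have hmn := h.lt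
  have h2 : (2 ^ m : ℂ) ≠ 0 := pow_ne_zero _ two_ne_zero
  obtain ⟨c, d, -, hcr⟩ := h.chain.exists_expansion_even (h.chain.bracket_mem_N x w)
    (bracket_even_even h.x_even h.chain.w_even)
  have h1 := h.chain.leib.even_right x h.chain.w_even h.x_even
  rw [h.x_x, h.w_x, hcr] at h1
  rw [map_add A.bracket, LinearMap.add_apply, h.sum_x, map_smul, hcr, LinearMap.map_smul₂, h.w_x,
    map_zero, LinearMap.zero_apply, sub_zero, smul_add, smul_comm d, add_left_inj,
    Finset.smul_sum] at h1
  have hr : A.bracket x w = c (2 * m - 1) • z (2 * m - 1) + d • w := by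
    have hc := h.chain.coeff_unique (fun j => 2 * m * c j) (fun j => (j + 1) * c j) (by
      rw [← h1]
      exact Finset.sum_congr rfl fun j _ => by rw [smul_smul])
    rw [hcr, Finset.sum_eq_single (2 * m - 1)]
    · intro j hj hj0
      have := hc j (Finset.mem_range.mp hj)
      have : ((2 * m : ℕ) - (j + 1 : ℕ) : ℂ) * c j = 0 := by
        push_cast; linear_combination this
      rw [(mul_eq_zero.mp this).resolve_left ?_, zero_smul]
      rw [sub_eq_zero]
      intro heq
      have : 2 * m = j + 1 := by exact_mod_cast heq
      omega
    · intro h0; exact absurd (Finset.mem_range.mpr (by omega)) h0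
  have hne := h.chain.z_ne (show 2 * m < 2 * n - 1 by omega)
  have hd : d = -(2 * m) := by
    have h4 := h.chain.leib.even_left (z 0) h.x_even h.chain.w_even
    rw [hr, map_add, map_smul, h.chain.bracket_z_of_two_le _ (by omega), map_smul, h.z_w, h.z_x,
      LinearMap.map_smul₂, LinearMap.map_smul₂, h.z_w, h.z_x, zero_add, ← sub_eq_zero] at h4
    have h5 : (2 ^ m * (d + 2 * m)) • z (2 * m) = 0 := by
      rw [← h4]; push_cast; module
    have h6 := (smul_eq_zero.mp h5).resolve_right hne
    linear_combination (mul_eq_zero.mp h6).resolve_left h2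
  have hc : c (2 * m - 1) = - 2 ^ m := by
    have h4 := h.chain.bracket_bracket_z_w x
    rw [hr, h.x_z0, LinearMap.map_neg₂, h.z_w, map_add, LinearMap.add_apply, LinearMap.map_smul₂,
      LinearMap.map_smul₂, h.chain.w_z, h.chain.z_succ, zero_add,
      show 2 * m - 1 + 1 = 2 * m by omega, ← sub_eq_zero] at h4
    have h5 : (c (2 * m - 1) + 2 ^ m) • z (2 * m) = 0 := by
      rw [← h4]; module
    linear_combination (smul_eq_zero.mp h5).resolve_right hne
  rw [hr, hd, hc]
  module

end IsDiagonal

end ChainModel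

end StandardForm

/-! ### Recognizing a superalgebra from its multiplication table. -/

section Table

variable {ι : Type*} [Fintype ι] {V W : Type*} [AddCommGroup V] [Module ℂ V] [AddCommGroup W]
  [Module ℂ W] {A : SuperAlgebra V}

lemma ofTable_bracket_single [DecidableEq ι] (par : ι → ZMod 2) (T : ι → ι → ι → ℂ)
    (hT : ∀ p q, T p q ∈ tablePart par (par p + par q)) (p q : ι) :
    (ofTable par T hT).bracket (Pi.single p 1) (Pi.single q 1) = T p q := by
  simp only [ofTable]
  rw [← Pi.basisFun_apply ℂ ι p, ← Pi.basisFun_apply ℂ ι q, Module.Basis.constr_basis,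
    Module.Basis.constr_basis]

lemma isomorphic_ofTable (par : ι → ZMod 2) (T : ι → ι → ι → ℂ)
    (hT : ∀ p q, T p q ∈ tablePart par (par p + par q)) (b : Module.Basis ι ℂ V)
    (hpar : ∀ p, b p ∈ A.part (par p))
    (hbr : ∀ p q, b.equivFun.symm (T p q) = A.bracket (b p) (b q)) :
    Isomorphic A (ofTable par T hT) := by
  classical
  have hmul : ∀ v u, b.equivFun.symm ((ofTable par T hT).bracket v u) =
      A.bracket (b.equivFun.symm v) (b.equivFun.symm u) := by
    have : (ofTable par T hT).bracket.compr₂ b.equivFun.symm.toLinearMap =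
        A.bracket.compl₁₂ b.equivFun.symm.toLinearMap b.equivFun.symm.toLinearMap := by
      refine (Pi.basisFun ℂ ι).ext fun p => (Pi.basisFun ℂ ι).ext fun q => ?_
      rw [Pi.basisFun_apply, Pi.basisFun_apply, LinearMap.compr₂_apply, LinearMap.compl₁₂_apply,
        ofTable_bracket_single]
      simp only [LinearEquiv.coe_coe]
      rw [hbr]
      congr 1 <;> simp [Module.Basis.equivFun_symm_apply]
    intro v u
    exact LinearMap.congr_fun₂ this v u
  have hmem : ∀ α (v : ι → ℂ), v ∈ tablePart par α → b.equivFun.symm v ∈ A.part α := by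
    intro α v hv
    rw [Module.Basis.equivFun_symm_apply]
    refine Submodule.sum_mem _ fun p _ => ?_
    by_cases hp : par p = α
    · rw [← hp]; exact Submodule.smul_mem _ _ (hpar p)
    · rw [hv p hp, zero_smul]; exact Submodule.zero_mem _
  have key : ∀ a : ZMod 2, a = 0 ∨ a = 1 := by decide
  refine ⟨b.equivFun, fun x y => ?_, fun α x => ⟨fun hx => ?_, fun hx => ?_⟩⟩
  · apply b.equivFun.symm.injective
    rw [hmul]; simp only [LinearEquiv.symm_apply_apply]
  · simpa using hmem α _ hx
  -- The basis is known only to be homogeneous. Splitting the image and mapping the pieces back,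
  -- directness of the grading removes the component of the wrong parity.
  · obtain ⟨v0, h0, v1, h1, hv⟩ := (ofTable par T hT).exists_even_add_odd (b.equivFun x)
    have hx' : b.equivFun.symm v0 + b.equivFun.symm v1 = x := by
      rw [← map_add, hv]; simp
    have m0 := hmem 0 v0 h0
    have m1 := hmem 1 v1 h1
    rcases key α with rfl | rfl
    · have : b.equivFun.symm v1 = 0 := eq_zero_of_mem_both (A := A) (by
        rw [← hx'] at hx; simpa using Submodule.sub_mem _ hx m0) m1
      rw [LinearEquiv.map_eq_zero_iff] at this
      rw [← hv, this, add_zero]; exact h0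
    · have : b.equivFun.symm v0 = 0 := eq_zero_of_mem_both (A := A) m0 (by
        rw [← hx'] at hx; simpa using Submodule.sub_mem _ hx m1)
      rw [LinearEquiv.map_eq_zero_iff] at this
      rw [← hv, this, zero_add]; exact h1

/-- The table is a linear expression in the vectors `e`, `y`, so it can be carried to any space and
compared there. -/
lemma map_hTable (φ : V →ₗ[ℂ] W) (n : ℕ) (β : ℕ → ℂ) (δ γ : ℂ) (e y : ℕ → V) (p q : NIdx n) :
    φ (hTable n β δ γ e y p q) = hTable n β δ γ (fun k => φ (e k)) (fun k => φ (y k)) p q := by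
  rcases p with i | i <;> rcases q with j | j <;>
    simp only [hTable, hEE, hYE, hEY, hYY] <;> split_ifs <;> simp

end Table

/-! ### The diagonal form as a member of the list. -/

section Basis

variable {V : Type*} [AddCommGroup V] [Module ℂ V] {A : SuperAlgebra V}

/-- The vectors `e_k` expressed through the chain `z 0, z 1, …` and `w`. -/
def chainE (z : ℕ → V) (w : V) : ℕ → V
  | 0 => 0
  | 1 => z 1
  | 2 => w
  | k + 3 => (2 ^ (k + 1) : ℂ) • z (2 * k + 3)

/-- The vectors `y_k` expressed through the chain `z 0, z 1, …`. -/
def chainY (z : ℕ → V) : ℕ → V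
  | 0 => 0
  | k + 1 => (2 ^ k : ℂ) • z (2 * k)

/-- The basis `e_1, …, e_n, y_1, …, y_n, x` expressed through the chain. -/
def chainBasis (n : ℕ) (z : ℕ → V) (w x : V) : LIdx n → V
  | .inl (.inl i) => chainE z w (i + 1)
  | .inl (.inr i) => chainY z (i + 1)
  | .inr _ => x

namespace ChainModel.IsDiagonal

variable {n m : ℕ} {N : Submodule ℂ V} {z : ℕ → V} {w x : V}

lemma top_le_span [FiniteDimensional ℂ V] (h : IsDiagonal A n m N z w x)
    (hN : Module.finrank ℂ (V ⧸ N) = 1) :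
    ⊤ ≤ Submodule.span ℂ (Set.range (chainBasis n z w x)) := by
  have h3 := h.chain.three_le
  have hz : ∀ j < 2 * n - 1, z j ∈ Submodule.span ℂ (Set.range (chainBasis n z w x)) := by
    intro j hj
    rcases Nat.even_or_odd' j with ⟨k, rfl | rfl⟩
    · have : (2 ^ k : ℂ) • z (2 * k) ∈ Submodule.span ℂ (Set.range (chainBasis n z w x)) :=
        Submodule.subset_span ⟨.inl (.inr ⟨k, by omega⟩), rfl⟩
      exact (Submodule.smul_mem_iff _ (pow_ne_zero k two_ne_zero)).mp this
    · rcases k with _ | k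
      · exact Submodule.subset_span ⟨.inl (.inl ⟨0, by omega⟩), rfl⟩
      · have : (2 ^ (k + 1) : ℂ) • z (2 * k + 3) ∈
            Submodule.span ℂ (Set.range (chainBasis n z w x)) :=
          Submodule.subset_span ⟨.inl (.inl ⟨k + 2, by omega⟩), rfl⟩
        exact (Submodule.smul_mem_iff _ (pow_ne_zero (k + 1) two_ne_zero)).mp this
  have hw : w ∈ Submodule.span ℂ (Set.range (chainBasis n z w x)) :=
    Submodule.subset_span ⟨.inl (.inl ⟨1, by omega⟩), rfl⟩
  have hx : x ∈ Submodule.span ℂ (Set.range (chainBasis n z w x)) :=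
    Submodule.subset_span ⟨.inr (), rfl⟩
  have hNle : N ≤ Submodule.span ℂ (Set.range (chainBasis n z w x)) := by
    intro u hu
    obtain ⟨c, d, rfl⟩ := h.chain.exists_expansion hu
    exact Submodule.add_mem _ (Submodule.sum_mem _ fun j hj =>
      Submodule.smul_mem _ _ (hz j (Finset.mem_range.mp hj))) (Submodule.smul_mem _ _ hw)
  intro v _
  obtain ⟨c, hc⟩ := (finrank_eq_one_iff_of_nonzero' (N.mkQ x)
    (by simpa using h.x_notMem)).mp hN (N.mkQ v)
  rw [← map_smul, ← sub_eq_zero, ← map_sub, Submodule.mkQ_apply,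
    Submodule.Quotient.mk_eq_zero] at hc
  have := Submodule.sub_mem _ (Submodule.smul_mem _ c hx) (hNle hc)
  rwa [sub_sub_cancel] at this

lemma chainE_of_lt (h : IsDiagonal A n m N z w x) {k : ℕ} (hk : n < k) : chainE z w k = 0 := by
  have h3 := h.chain.three_le
  obtain ⟨k, rfl⟩ : ∃ l, k = l + 3 := ⟨k - 3, by omega⟩
  simp only [chainE]
  rw [h.chain.z_zero _ (by omega), smul_zero]

lemma chainY_of_lt (h : IsDiagonal A n m N z w x) {k : ℕ} (hk : n < k) : chainY z k = 0 := by
  obtain ⟨k, rfl⟩ : ∃ l, k = l + 1 := ⟨k - 1, by omega⟩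
  simp only [chainY]
  rw [h.chain.z_zero _ (by omega), smul_zero]

lemma bracket_chainE_of_three_le (h : IsDiagonal A n m N z w x) (u : V) {k : ℕ} (hk : 3 ≤ k) :
    A.bracket u (chainE z w k) = 0 := by
  obtain ⟨k, rfl⟩ : ∃ l, k = l + 3 := ⟨k - 3, by omega⟩
  simp only [chainE]
  rw [map_smul, h.chain.bracket_z_of_two_le _ (by omega), smul_zero]

lemma bracket_chainY_of_two_le (h : IsDiagonal A n m N z w x) (u : V) {k : ℕ} (hk : 2 ≤ k) :
    A.bracket u (chainY z k) = 0 := by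
  obtain ⟨k, rfl⟩ : ∃ l, k = l + 2 := ⟨k - 2, by omega⟩
  simp only [chainY]
  rw [map_smul, h.chain.bracket_z_of_two_le _ (by omega), smul_zero]

/-- The hypothesis `hβ` says that `β` is the indicator of `m + 2`, in the form of truncated sums. It
also covers `m + 1 = n`, where every sum is empty and `δ` takes over the role of the nonzero
parameter. -/
lemma hEE_eq (h : IsDiagonal A n m N z w x) {β : ℕ → ℂ}
    (hβ : ∀ r ≤ n, ∀ f : ℕ → V, ∑ k ∈ Finset.Icc 4 r, β k • f k = if m + 2 ≤ r then f (m + 2) else 0)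
    (i j : ℕ) (hi : 1 ≤ i) (hj : 1 ≤ j) :
    hEE n β 0 (chainE z w) i j = A.bracket (chainE z w i) (chainE z w j) := by
  have h3 := h.chain.three_le
  have hm := h.two_le
  have hmn := h.lt
  unfold hEE
  obtain ⟨l, rfl⟩ : ∃ l, m = l + 1 := ⟨m - 1, by omega⟩
  rcases (show j = 1 ∨ j = 2 ∨ 3 ≤ j by omega) with rfl | rfl | hj3
  · rw [if_pos rfl]
    rcases (show i = 1 ∨ i = 2 ∨ ∃ k, i = k + 3 from by
      rcases (show i = 1 ∨ i = 2 ∨ 3 ≤ i by omega) with h | h | h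
      · exact Or.inl h
      · exact Or.inr (Or.inl h)
      · exact Or.inr (Or.inr ⟨i - 3, by omega⟩)) with rfl | rfl | ⟨k, rfl⟩
    · simp only [if_pos, chainE]
      rw [h.chain.bracket_z_one, h.chain.z_succ, h.chain.z_succ]
      simp
    · simp only [chainE]
      rw [h.chain.bracket_w_z_one]; simp
    · simp only [chainE]
      rw [if_neg (by omega), LinearMap.map_smul₂, h.chain.bracket_z_one, h.chain.z_succ,
        h.chain.z_succ]
      split_ifs with hc
      · rw [smul_smul, ← pow_succ]; rfl
      · rw [h.chain.z_zero _ (by omega)]; simp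
  · rw [if_neg (by omega), if_pos rfl]
    rcases (show i = 1 ∨ i = 2 ∨ ∃ k, i = k + 3 from by
      rcases (show i = 1 ∨ i = 2 ∨ 3 ≤ i by omega) with h | h | h
      · exact Or.inl h
      · exact Or.inr (Or.inl h)
      · exact Or.inr (Or.inr ⟨i - 3, by omega⟩)) with rfl | rfl | ⟨k, rfl⟩
    · rw [if_pos rfl, hβ n le_rfl]
      simp only [chainE]
      rw [h.z_w]
      split_ifs with hc
      · congr 2; ring
      · rw [h.chain.z_zero _ (by omega), smul_zero]
    · rw [if_neg (by omega), if_pos rfl]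
      simp only [chainE]
      rw [h.chain.w_w, zero_smul]
    · rw [if_neg (by omega), if_neg (by omega)]
      have hb : A.bracket (chainE z w (k + 3)) (chainE z w 2) =
          (2 ^ (k + 1 + (l + 1)) : ℂ) • z (2 * (k + 1 + l) + 3) := by
        simp only [chainE]
        rw [LinearMap.map_smul₂, h.z_w, smul_smul, ← pow_add]
        congr 2; ring
      rw [hb]
      split_ifs with hc
      · rw [hβ _ (by omega)]
        split_ifs with hc'
        · rw [show k + 3 + (l + 1 + 2) - 2 = (k + 1 + l) + 3 by omega]
          simp only [chainE]
          congr 2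
        · rw [h.chain.z_zero _ (by omega), smul_zero]
      · rw [h.chain.z_zero _ (by omega), smul_zero]
  · rw [if_neg (by omega), if_neg (by omega), h.bracket_chainE_of_three_le _ hj3]

lemma hYE_eq (h : IsDiagonal A n m N z w x) {β : ℕ → ℂ} {δ : ℂ}
    (hβ : ∀ r ≤ n, ∀ f : ℕ → V, ∑ k ∈ Finset.Icc 4 r, β k • f k = if m + 2 ≤ r then f (m + 2) else 0)
    (hδ : δ = if m + 1 = n then 1 else 0) (i j : ℕ) (hi : 1 ≤ i) (hj : 1 ≤ j) :
    hYE n β δ (chainY z) i j = A.bracket (chainY z i) (chainE z w j) := by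
  have h3 := h.chain.three_le
  have hm := h.two_le
  have hmn := h.lt
  unfold hYE
  obtain ⟨i, rfl⟩ : ∃ k, i = k + 1 := ⟨i - 1, by omega⟩
  rcases (show j = 1 ∨ j = 2 ∨ 3 ≤ j by omega) with rfl | rfl | hj3
  · rw [if_pos rfl]
    simp only [chainE, chainY]
    rw [LinearMap.map_smul₂, h.chain.bracket_z_one, h.chain.z_succ, h.chain.z_succ]
    split_ifs with hc
    · rw [smul_smul, ← pow_succ]; rfl
    · rw [h.chain.z_zero _ (by omega)]; simp
  · have hb : A.bracket (chainY z (i + 1)) (chainE z w 2) = chainY z (i + m + 1) := by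
      simp only [chainE, chainY]
      rw [LinearMap.map_smul₂, h.z_w, smul_smul, ← pow_add]
      congr 2; ring
    rw [if_neg (by omega), if_pos rfl, hb]
    split_ifs with hi1 hc
    · obtain rfl : i = 0 := by omega
      rw [hβ n le_rfl, hδ]
      split_ifs
      · omega
      · simp
      · rw [show n = m + 1 by omega]; simp
      · omega
    · rw [hβ _ (by omega)]
      split_ifs
      · congr 1; omega
      · rw [h.chainY_of_lt (by omega)]
    · rw [h.chainY_of_lt (by omega)]
  · rw [if_neg (by omega), if_neg (by omega), h.bracket_chainE_of_three_le _ hj3]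

lemma hEY_eq (h : IsDiagonal A n m N z w x) (i j : ℕ) (hi : 1 ≤ i) (hj : 1 ≤ j) :
    hEY (chainY z) i j = A.bracket (chainE z w i) (chainY z j) := by
  unfold hEY
  rcases (show j = 1 ∨ 2 ≤ j by omega) with rfl | hj2
  · rw [if_pos rfl]
    rcases (show i = 1 ∨ i = 2 ∨ ∃ k, i = k + 3 from by
      rcases (show i = 1 ∨ i = 2 ∨ 3 ≤ i by omega) with h | h | h
      · exact Or.inl h
      · exact Or.inr (Or.inl h)
      · exact Or.inr (Or.inr ⟨i - 3, by omega⟩)) with rfl | rfl | ⟨k, rfl⟩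
    · simp only [chainE, chainY, if_pos]
      rw [map_smul, h.chain.z_succ]
      simp
    · simp only [chainE, chainY]
      rw [map_smul, h.chain.w_z]; simp
    · simp only [chainE, chainY]
      rw [if_neg (by omega), if_pos (by omega), map_smul, LinearMap.map_smul₂, h.chain.z_succ,
        show 2 * (k + 2) = 2 * k + 3 + 1 by ring]
      simp only [smul_smul]
      congr 1
      ring
  · rw [if_neg (by omega), h.bracket_chainY_of_two_le _ hj2]

lemma hYY_eq (h : IsDiagonal A n m N z w x) (i j : ℕ) (hi : 1 ≤ i) (hj : 1 ≤ j) :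
    hYY n (chainE z w) i j = A.bracket (chainY z i) (chainY z j) := by
  unfold hYY
  rcases (show j = 1 ∨ 2 ≤ j by omega) with rfl | hj2
  · rw [if_pos rfl]
    rcases (show i = 1 ∨ ∃ k, i = k + 2 from by
      rcases (show i = 1 ∨ 2 ≤ i by omega) with h | h
      · exact Or.inl h
      · exact Or.inr ⟨i - 2, by omega⟩) with rfl | ⟨k, rfl⟩
    · simp only [chainE, chainY, if_pos]
      rw [map_smul, LinearMap.map_smul₂, h.chain.z_succ]
      simp
    · simp only [chainE, chainY]
      rw [if_neg (by omega), map_smul, LinearMap.map_smul₂, h.chain.z_succ]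
      split_ifs with hc
      · simp only [pow_zero, one_smul]; congr 2
      · rw [h.chain.z_zero _ (by omega)]; simp
  · rw [if_neg (by omega), h.bracket_chainY_of_two_le _ hj2]

lemma isomorphic_shExt [FiniteDimensional ℂ V] (h : IsDiagonal A n m N z w x)
    (hN : Module.finrank ℂ (V ⧸ N) = 1) {β : ℕ → ℂ} {δ b : ℂ} {s : ℕ}
    (hβ : ∀ r ≤ n, ∀ f : ℕ → V, ∑ k ∈ Finset.Icc 4 r, β k • f k = if m + 2 ≤ r then f (m + 2) else 0)
    (hδ : δ = if m + 1 = n then 1 else 0) (hb : b = 2 * m) (hs : s = m + 1) :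
    Isomorphic A (shExt n β δ 0 b 2 s) := by
  have h3 := h.chain.three_le
  have hm := h.two_le
  have hmn := h.lt
  let B := basisOfTopLeSpanOfCardEqFinrank (chainBasis n z w x) (h.top_le_span hN) (by
    have := Submodule.finrank_quotient_add_finrank N
    rw [hN, h.chain.finrank_eq] at this
    simp [← this]; omega)
  have hB : ∀ p, B p = chainBasis n z w x p := fun p => by simp [B]
  have hE : ∀ k, B.equivFun.symm (lE n k) = chainE z w k := by
    intro k
    rw [Module.Basis.equivFun_symm_apply, Fintype.sum_sum_type, Fintype.sum_sum_type]
    simp only [lE, nE, zero_smul, Finset.sum_const_zero, add_zero, hB, chainBasis]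
    rcases (show k = 0 ∨ 1 ≤ k ∧ k ≤ n ∨ n < k by omega) with rfl | ⟨h1, h2⟩ | hk
    · simp [chainE]
    · rw [Finset.sum_eq_single ⟨k - 1, by omega⟩]
      · simp [show k - 1 + 1 = k by omega]
      · intro i _ hi
        rw [if_neg, zero_smul]
        rintro rfl
        exact hi (by simp)
      · simp
    · rw [h.chainE_of_lt hk]
      refine Finset.sum_eq_zero fun i _ => ?_
      rw [if_neg (by have := i.2; omega), zero_smul]
  have hY : ∀ k, B.equivFun.symm (lY n k) = chainY z k := by
    intro k
    rw [Module.Basis.equivFun_symm_apply, Fintype.sum_sum_type, Fintype.sum_sum_type]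
    simp only [lY, nY, zero_smul, Finset.sum_const_zero, add_zero, zero_add, hB, chainBasis]
    rcases (show k = 0 ∨ 1 ≤ k ∧ k ≤ n ∨ n < k by omega) with rfl | ⟨h1, h2⟩ | hk
    · simp [chainY]
    · rw [Finset.sum_eq_single ⟨k - 1, by omega⟩]
      · simp [show k - 1 + 1 = k by omega]
      · intro i _ hi
        rw [if_neg, zero_smul]
        rintro rfl
        exact hi (by simp)
      · simp
    · rw [h.chainY_of_lt hk]
      refine Finset.sum_eq_zero fun i _ => ?_
      rw [if_neg (by have := i.2; omega), zero_smul]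
  refine isomorphic_ofTable _ _ _ B ?_ ?_
  · intro p
    rw [hB]
    rcases p with (⟨i, hi⟩ | ⟨i, hi⟩) | u
    · simp only [chainBasis, lPar, nPar]
      rcases i with _ | _ | i
      · exact h.chain.z1_even
      · exact h.chain.w_even
      · exact Submodule.smul_mem _ _ (h.chain.z_odd (i + 1))
    · exact Submodule.smul_mem _ _ (h.chain.z_even i)
    · exact h.x_even
  · intro p q
    rw [hB, hB]
    rcases p with p | u
    · rcases q with q | u
      · simp only [shTable]
        rw [← LinearEquiv.coe_coe, map_hTable]
        simp only [LinearEquiv.coe_coe, hE, hY]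
        rcases p with i | i <;> rcases q with j | j <;> simp only [hTable, chainBasis]
        · exact h.hEE_eq hβ _ _ (by omega) (by omega)
        · exact h.hEY_eq _ _ (by omega) (by omega)
        · exact h.hYE_eq hβ hδ _ _ (by omega) (by omega)
        · exact h.hYY_eq _ _ (by omega) (by omega)
      · rcases p with ⟨i, hi⟩ | ⟨i, hi⟩ <;> simp only [shTable, chainBasis]
        · rcases i with _ | _ | i
          · rw [if_pos rfl, map_smul, hE]
            simp only [chainE]
            rw [h.z_x]; norm_num
          · rw [if_neg (by omega), if_pos rfl, map_smul, hE, hb]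
            simp only [chainE]
            rw [h.w_x]
          · rw [if_neg (by omega), if_neg (by omega), map_smul, hE]
            simp only [chainE]
            rw [LinearMap.map_smul₂, h.z_x, smul_smul, smul_smul]
            congr 1; push_cast; ring
        · rw [map_smul, hY]
          simp only [chainY]
          rw [LinearMap.map_smul₂, h.z_x, smul_smul, smul_smul]
          congr 1; push_cast; ring
    · rcases q with (⟨i, hi⟩ | ⟨i, hi⟩) | u <;> simp only [shTable, chainBasis]
      · rcases i with _ | _ | i
        · rw [if_pos rfl, map_smul, hE]
          simp only [chainE]
          rw [h.x_z1]
        · rw [if_neg (by omega), if_pos rfl, map_sub, map_smul, map_smul, hE, hE, hb, hs]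
          -- With this shift `e_{m+1}` is `2 ^ (m-1) z (2m-1)`, so the term `2 ^ m z (2m-1)` of
          -- `x_w` is `2 e_{m+1}`; hence the constant 2 in the table.
          obtain ⟨l, rfl⟩ : ∃ l, m = l + 2 := ⟨m - 2, by omega⟩
          simp only [chainE]
          rw [h.x_w, smul_smul, show 2 * (l + 2) - 1 = 2 * l + 3 by omega]
          congr 2; ring
        · rw [if_neg (by omega), if_neg (by omega), map_zero,
            h.bracket_chainE_of_three_le _ (by omega)]
      · rcases i with _ | i
        · rw [if_pos rfl, map_neg, hY]
          simp only [chainY]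
          rw [map_smul, h.x_z0]; simp
        · rw [if_neg (by omega), map_zero, h.bracket_chainY_of_two_le _ (by omega)]
      · rw [map_zero, h.x_x]

/-- A superalgebra in diagonal form is isomorphic to `SH1` or to `SH2`. -/
lemma exists_isomorphic_SH [FiniteDimensional ℂ V] (h : IsDiagonal A n m N z w x)
    (hN : Module.finrank ℂ (V ⧸ N) = 1) : ∃ l : SHLabel n, Isomorphic A (SH n l) := by
  have h3 := h.chain.three_le
  have hm := h.two_le
  have hmn := h.lt
  rcases (show m + 2 ≤ n ∨ m + 1 = n by omega) with hle | heq
  · refine ⟨.sh1 (m + 2) (by omega) hle, h.isomorphic_shExt hN ?_ ?_ ?_ ?_⟩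
    · intro r _ f
      simp only [ite_smul, one_smul, zero_smul, Finset.sum_ite_eq', Finset.mem_Icc]
      congr 1
      simp only [eq_iff_iff]; omega
    · rw [if_neg (by omega)]
    · push_cast; ring
    · omega
  · refine ⟨.sh2, h.isomorphic_shExt hN ?_ ?_ ?_ ?_⟩
    · intro r _ f
      rw [if_neg (by omega)]; simp
    · rw [if_pos heq]
    · rw [← heq]; push_cast; ring
    · omega

end ChainModel.IsDiagonal

end Basis

/-! ### Recovering the chain from the table of `H`, without the superidentity. -/

section Extraction

variable {V : Type*} [AddCommGroup V] [Module ℂ V]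

/-- The iterated right products of `y_1` with itself, expressed through the vectors `e_k` and
`y_k`. -/
noncomputable def chainZ (E Y : ℕ → V) (j : ℕ) : V :=
  if j = 1 then E 1 else
    if Even j then (1 / 2 : ℂ) ^ (j / 2) • Y (j / 2 + 1) else (1 / 2 : ℂ) ^ (j / 2) • E (j / 2 + 2)

lemma chainZ_zero (E Y : ℕ → V) : chainZ E Y 0 = Y 1 := by simp [chainZ]

lemma chainZ_one (E Y : ℕ → V) : chainZ E Y 1 = E 1 := by simp [chainZ]

lemma chainZ_even (E Y : ℕ → V) (i : ℕ) :
    chainZ E Y (2 * i) = (1 / 2 : ℂ) ^ i • Y (i + 1) := by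
  rw [chainZ, if_neg (by omega), if_pos (even_two_mul i), Nat.mul_div_cancel_left _ two_pos]

lemma chainZ_odd (E Y : ℕ → V) (i : ℕ) :
    chainZ E Y (2 * i + 3) = (1 / 2 : ℂ) ^ (i + 1) • E (i + 3) := by
  rw [chainZ, if_neg (by omega), if_neg (by rw [Nat.even_iff]; omega),
    show (2 * i + 3) / 2 = i + 1 by omega]

lemma two_pow_smul_chainZ_even (E Y : ℕ → V) (i : ℕ) :
    (2 : ℂ) ^ i • chainZ E Y (2 * i) = Y (i + 1) := by
  rw [chainZ_even, smul_smul, ← mul_pow]; norm_num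

lemma two_pow_smul_chainZ_odd (E Y : ℕ → V) (i : ℕ) :
    (2 : ℂ) ^ (i + 1) • chainZ E Y (2 * i + 3) = E (i + 3) := by
  rw [chainZ_odd, smul_smul, ← mul_pow]; norm_num

/-- The products of the vectors `E 1, …, E n, Y 1, …, Y n` are given by the table of
`H(β₄, …, βₙ, δ, γ)`. -/
structure HasHTable (A : SuperAlgebra V) (n : ℕ) (β : ℕ → ℂ) (δ γ : ℂ) (E Y : ℕ → V) : Prop where
  three_le : 3 ≤ n
  E_zero : ∀ k, n < k → E k = 0
  Y_zero : ∀ k, n < k → Y k = 0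
  E_E : ∀ i j, 1 ≤ i → i ≤ n → 1 ≤ j → j ≤ n → A.bracket (E i) (E j) = hEE n β γ E i j
  Y_E : ∀ i j, 1 ≤ i → i ≤ n → 1 ≤ j → j ≤ n → A.bracket (Y i) (E j) = hYE n β δ Y i j
  E_Y : ∀ i j, 1 ≤ i → i ≤ n → 1 ≤ j → j ≤ n → A.bracket (E i) (Y j) = hEY Y i j
  Y_Y : ∀ i j, 1 ≤ i → i ≤ n → 1 ≤ j → j ≤ n → A.bracket (Y i) (Y j) = hYY n E i j

namespace HasHTable

variable {A : SuperAlgebra V} {n : ℕ} {β : ℕ → ℂ} {δ γ : ℂ} {E Y : ℕ → V}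

lemma chainZ_eq_zero (h : HasHTable A n β δ γ E Y) {j : ℕ} (hj : 2 * n - 1 ≤ j) :
    chainZ E Y j = 0 := by
  have h3 := h.three_le
  rcases Nat.even_or_odd' j with ⟨i, rfl | rfl⟩
  · rw [chainZ_even, h.Y_zero _ (by omega), smul_zero]
  · obtain ⟨i, rfl⟩ : ∃ l, i = l + 1 := ⟨i - 1, by omega⟩
    rw [show 2 * (i + 1) + 1 = 2 * i + 3 by ring, chainZ_odd, h.E_zero _ (by omega), smul_zero]

lemma chainZ_succ (h : HasHTable A n β δ γ E Y) (j : ℕ) :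
    A.bracket (chainZ E Y j) (chainZ E Y 0) = chainZ E Y (j + 1) := by
  have h3 := h.three_le
  rcases Nat.lt_or_ge j (2 * n - 1) with hj | hj
  swap
  · rw [h.chainZ_eq_zero hj, h.chainZ_eq_zero (show 2 * n - 1 ≤ j + 1 by omega)]; simp
  rw [chainZ_zero]
  rcases Nat.even_or_odd' j with ⟨i, rfl | rfl⟩
  · rw [chainZ_even, LinearMap.map_smul₂, h.Y_Y _ _ (by omega) (by omega) le_rfl (by omega), hYY,
      if_pos rfl]
    rcases i with _ | i
    · simp [chainZ_one]
    · rw [if_neg (by omega), show 2 * (i + 1) + 1 = 2 * i + 3 by ring, chainZ_odd]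
      split_ifs with hi
      · rfl
      · rw [h.E_zero (i + 3) (by omega)]
  · rcases i with _ | i
    · rw [mul_zero, zero_add, chainZ_one, h.E_Y _ _ le_rfl (by omega) le_rfl (by omega), hEY,
        if_pos rfl, if_pos rfl, show 1 + 1 = 2 * 1 by rfl, chainZ_even, pow_one]
    · rw [show 2 * (i + 1) + 1 = 2 * i + 3 by ring, chainZ_odd, LinearMap.map_smul₂,
        h.E_Y _ _ (by omega) (by omega) le_rfl (by omega), hEY, if_pos rfl, if_neg (by omega),
        if_pos (by omega), show 2 * i + 3 + 1 = 2 * (i + 2) by ring, chainZ_even, smul_smul]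
      congr 1

lemma E_two_chainZ (h : HasHTable A n β δ γ E Y) : A.bracket (E 2) (chainZ E Y 0) = 0 := by
  have h3 := h.three_le
  rw [chainZ_zero, h.E_Y _ _ (by omega) (by omega) le_rfl (by omega)]
  simp [hEY]

lemma E_two_E_two (h : HasHTable A n β δ γ E Y) :
    A.bracket (E 2) (E 2) = (γ * 2 ^ (n - 2)) • chainZ E Y (2 * n - 3) := by
  have h3 := h.three_le
  obtain ⟨k, rfl⟩ : ∃ k, n = k + 3 := ⟨n - 3, by omega⟩
  rw [h.E_E _ _ (by omega) (by omega) (by omega) (by omega), hEE, if_neg (by omega), if_pos rfl,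
    if_neg (by omega), if_pos rfl, mul_smul, show 2 * (k + 3) - 3 = 2 * k + 3 by omega,
    show k + 3 - 2 = k + 1 by omega, two_pow_smul_chainZ_odd]

/-- The term `β_k y_{k-1}` sits at chain index `2m` with `m = k - 2`, and `δ y_n` at `m = n - 1`, so
the positions do not overlap. -/
lemma chainZ_zero_E_two (h : HasHTable A n β δ γ E Y) :
    A.bracket (chainZ E Y 0) (E 2) = ∑ m ∈ Finset.range n,
      (2 ^ m * if m + 1 = n then δ else if 2 ≤ m then β (m + 2) else 0) • chainZ E Y (2 * m) := by
  have h3 := h.three_le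
  have hsum : ∑ k ∈ Finset.Icc 4 n, β k • Y (k - 1) = ∑ m ∈ Finset.range (n - 1),
      (if 2 ≤ m then β (m + 2) else 0) • Y (m + 1) := by
    simp only [ite_smul, zero_smul]
    rw [← Finset.sum_filter]
    symm
    refine Finset.sum_bij (fun m _ => m + 2) ?_ ?_ ?_ ?_
    · intro m hm
      simp only [Finset.mem_filter, Finset.mem_range] at hm
      simp only [Finset.mem_Icc]; omega
    · intro a _ b _ hab; omega
    · intro k hk
      simp only [Finset.mem_Icc] at hk
      exact ⟨k - 2, by simp only [Finset.mem_filter, Finset.mem_range]; omega, by omega⟩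
    · intro m _
      congr 2
  rw [chainZ_zero, h.Y_E _ _ le_rfl (by omega) (by omega) (by omega), hYE, if_neg (by omega),
    if_pos rfl, if_pos rfl, hsum]
  obtain ⟨k, rfl⟩ : ∃ k, n = k + 1 := ⟨n - 1, by omega⟩
  rw [Nat.add_sub_cancel, Finset.sum_range_succ, if_pos rfl, mul_comm, mul_smul,
    two_pow_smul_chainZ_even]
  congr 1
  refine Finset.sum_congr rfl fun m hm => ?_
  have := Finset.mem_range.mp hm
  rw [if_neg (show ¬ m + 1 = k + 1 by omega), mul_comm, mul_smul, two_pow_smul_chainZ_even]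

lemma chainZ_even_E_two (h : HasHTable A n β δ γ E Y) {m : ℕ} {c : ℂ} (hm : 2 ≤ m) (hmn : m < n)
    (hβ : ∀ k ≤ n, β k = if k = m + 2 then c else 0) (hδ : δ = if m + 1 = n then c else 0)
    (i : ℕ) : A.bracket (chainZ E Y (2 * i)) (E 2) =
      (c * 2 ^ m) • chainZ E Y (2 * i + 2 * m) := by
  have h3 := h.three_le
  have hsum : ∀ r ≤ n, ∀ f : ℕ → V, ∑ k ∈ Finset.Icc 4 r, β k • f k =
      if m + 2 ≤ r then c • f (m + 2) else 0 := by
    intro r hr f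
    rw [Finset.sum_congr rfl fun k hk =>
      by rw [hβ k ((Finset.mem_Icc.mp hk).2.trans hr)]]
    simp only [ite_smul, zero_smul, Finset.sum_ite_eq', Finset.mem_Icc]
    congr 1
    simp only [eq_iff_iff]; omega
  have key : ∀ i, 1 ≤ i → i ≤ n → A.bracket (Y i) (E 2) = c • Y (i + m) := by
    intro i h1 hi
    rw [h.Y_E _ _ h1 hi (by omega) (by omega), hYE, if_neg (by omega), if_pos rfl]
    split_ifs with hi1 hc
    · subst hi1
      rw [hsum n le_rfl fun k => Y (k - 1), hδ]
      split_ifs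
      · omega
      · rw [zero_smul, add_zero]; congr 2; omega
      · rw [zero_add]; congr 2; omega
      · omega
    · rw [hsum _ (by omega) fun k => Y (i + k - 2)]
      split_ifs
      · congr 1
      · rw [h.Y_zero _ (by omega), smul_zero]
    · rw [h.Y_zero _ (by omega), smul_zero]
  rcases Nat.lt_or_ge i n with hi | hi
  · have hpow : (2 : ℂ) ^ m = (1 / 2) ^ i * 2 ^ (i + m) := by
      rw [pow_add, ← mul_assoc, ← mul_pow]; norm_num
    rw [← mul_add, mul_smul, hpow, mul_smul, two_pow_smul_chainZ_even, chainZ_even,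
      LinearMap.map_smul₂, key _ (by omega) (by omega), smul_comm,
      show i + 1 + m = i + m + 1 by ring]
  · rw [h.chainZ_eq_zero (by omega), h.chainZ_eq_zero (by omega)]; simp

end HasHTable

end Extraction

/-! ### Passing from the abstract nilradical to the chain model; the split case. -/

section Family

variable {V : Type*} [AddCommGroup V] [Module ℂ V] {A : SuperAlgebra V}

/-- The family `E 1, …, E n, Y 1, …, Y n`. -/
def nVec (n : ℕ) (E Y : ℕ → V) : NIdx n → V
  | .inl i => E (i.val + 1)
  | .inr i => Y (i.val + 1)

lemma HasHTable.of_table {n : ℕ} (hn : 3 ≤ n) {β : ℕ → ℂ} {δ γ : ℂ} {E Y : ℕ → V}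
    (hE : ∀ k, n < k → E k = 0) (hY : ∀ k, n < k → Y k = 0)
    (hT : ∀ p q, A.bracket (nVec n E Y p) (nVec n E Y q) = hTable n β δ γ E Y p q) :
    HasHTable A n β δ γ E Y where
  three_le := hn
  E_zero := hE
  Y_zero := hY
  E_E i j hi hi' hj hj' := by
    simpa [hTable, nVec, Nat.sub_add_cancel hi, Nat.sub_add_cancel hj] using
      hT (.inl ⟨i - 1, by omega⟩) (.inl ⟨j - 1, by omega⟩)
  Y_E i j hi hi' hj hj' := by
    simpa [hTable, nVec, Nat.sub_add_cancel hi, Nat.sub_add_cancel hj] using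
      hT (.inr ⟨i - 1, by omega⟩) (.inl ⟨j - 1, by omega⟩)
  E_Y i j hi hi' hj hj' := by
    simpa [hTable, nVec, Nat.sub_add_cancel hi, Nat.sub_add_cancel hj] using
      hT (.inl ⟨i - 1, by omega⟩) (.inr ⟨j - 1, by omega⟩)
  Y_Y i j hi hi' hj hj' := by
    simpa [hTable, nVec, Nat.sub_add_cancel hi, Nat.sub_add_cancel hj] using
      hT (.inr ⟨i - 1, by omega⟩) (.inr ⟨j - 1, by omega⟩)

lemma nE_eq_single (n : ℕ) (i : Fin n) : nE n (i + 1) = Pi.single (.inl i) 1 := by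
  funext p
  rcases p with j | j
  · simp [nE, Pi.single_apply, Fin.ext_iff]
  · simp [nE]

lemma nY_eq_single (n : ℕ) (i : Fin n) : nY n (i + 1) = Pi.single (.inr i) 1 := by
  funext p
  rcases p with j | j
  · simp [nY]
  · simp [nY, Pi.single_apply, Fin.ext_iff]

lemma nE_eq_zero {n k : ℕ} (hk : n < k) : nE n k = 0 := by
  funext p
  rcases p with j | j
  · simp only [nE, Pi.zero_apply]; rw [if_neg (by have := j.2; omega)]
  · rfl

lemma nY_eq_zero {n k : ℕ} (hk : n < k) : nY n k = 0 := by
  funext p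
  rcases p with j | j
  · rfl
  · simp only [nY, Pi.zero_apply]; rw [if_neg (by have := j.2; omega)]

lemma nE_mem (n k : ℕ) : nE n k ∈ tablePart (nPar n) 0 := by
  intro p hp; cases p <;> simp_all [nE, nPar]

lemma nY_mem (n k : ℕ) : nY n k ∈ tablePart (nPar n) 1 := by
  intro p hp; cases p <;> simp_all [nY, nPar]

lemma familyH_bracket_single (n : ℕ) (β : ℕ → ℂ) (δ γ : ℂ) (p q : NIdx n) :
    (familyH n β δ γ).bracket (Pi.single p 1) (Pi.single q 1) =
      hTable n β δ γ (nE n) (nY n) p q :=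
  ofTable_bracket_single _ _ _ p q

lemma exists_hasHTable {n : ℕ} (hn : 3 ≤ n) {N : Submodule ℂ V} (hN : A.IsIdeal N) {β : ℕ → ℂ}
    {δ γ : ℂ} (h : Isomorphic (A.restrict N hN) (familyH n β δ γ)) :
    Module.finrank ℂ N = 2 * n ∧ ∃ E Y : ℕ → V, HasHTable A n β δ γ E Y ∧
      (∀ k, E k ∈ N ∧ E k ∈ A.part 0) ∧ (∀ k, Y k ∈ N ∧ Y k ∈ A.part 1) ∧
      (∀ k, 1 ≤ k → k ≤ n → E k ≠ 0 ∧ Y k ≠ 0) := by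
  obtain ⟨f, hf, hfp⟩ := h
  refine ⟨?_, fun k => (f.symm (nE n k) : V), fun k => (f.symm (nY n k) : V), ?_, fun k => ⟨?_, ?_⟩,
    fun k => ⟨?_, ?_⟩, fun k h1 hk => ⟨?_, ?_⟩⟩
  · rw [f.finrank_eq]; simp; ring
  · refine HasHTable.of_table hn ?_ ?_ ?_
    · intro k hk; rw [nE_eq_zero hk]; simp
    · intro k hk; rw [nY_eq_zero hk]; simp
    · intro p q
      have hvec : ∀ p, nVec n (fun k => (f.symm (nE n k) : V)) (fun k => (f.symm (nY n k) : V)) p =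
          f.symm (Pi.single p 1) := by
        rintro (i | i) <;> simp only [nVec]
        · rw [nE_eq_single]
        · rw [nY_eq_single]
      rw [hvec, hvec]
      have h1 := hf (f.symm (Pi.single p 1)) (f.symm (Pi.single q 1))
      rw [LinearEquiv.apply_symm_apply, LinearEquiv.apply_symm_apply, familyH_bracket_single,
        ← LinearEquiv.eq_symm_apply] at h1
      have h2 := congrArg N.subtype h1
      have h3 := map_hTable (N.subtype ∘ₗ f.symm.toLinearMap) n β δ γ (nE n) (nY n) p q
      exact h2.trans h3
  · exact (f.symm (nE n k)).2
  · exact (hfp 0 (f.symm (nE n k))).mp (by rw [LinearEquiv.apply_symm_apply]; exact nE_mem n k)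
  · exact (f.symm (nY n k)).2
  · exact (hfp 1 (f.symm (nY n k))).mp (by rw [LinearEquiv.apply_symm_apply]; exact nY_mem n k)
  · obtain ⟨i, rfl⟩ : ∃ i : Fin n, k = i + 1 := ⟨⟨k - 1, by omega⟩, by simp; omega⟩
    beta_reduce
    rw [nE_eq_single]
    simp
  · obtain ⟨i, rfl⟩ : ∃ i : Fin n, k = i + 1 := ⟨⟨k - 1, by omega⟩, by simp; omega⟩
    beta_reduce
    rw [nY_eq_single]
    simp

/-- The coefficients of the right multiplication by `e_2` on `y_1`. -/
noncomputable def chainCoeff (n : ℕ) (β : ℕ → ℂ) (δ : ℂ) (m : ℕ) : ℂ :=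
  2 ^ m * if m + 1 = n then δ else if 2 ≤ m then β (m + 2) else 0

/-- In a Leibniz superalgebra whose nilradical is `H(β₄, …, βₙ, δ, γ)` the parameter `γ` vanishes,
and the nilradical has a basis adapted to the right multiplication by `y_1`. -/
lemma exists_chainModel {n : ℕ} (hn : 3 ≤ n) {N : Submodule ℂ V} (hN : A.IsNilradical N)
    (hA : A.IsLeibniz) {β : ℕ → ℂ} {δ γ : ℂ}
    (h : Isomorphic (A.restrict N hN.prop.1) (familyH n β δ γ)) :
    γ = 0 ∧ ∃ (z : ℕ → V) (w : V), ChainModel A n N z w (chainCoeff n β δ) := by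
  obtain ⟨hfin, E, Y, hT, hE, hY, hne⟩ := exists_hasHTable hn hN.prop.1 h
  have hw := hT.E_two_chainZ
  have hww := hT.E_two_E_two
  have hz0 : chainZ E Y 0 ∈ A.part 1 := by rw [chainZ_zero]; exact (hY 1).2
  have htop : chainZ E Y (2 * n - 2) ≠ 0 := by
    rw [show 2 * n - 2 = 2 * (n - 1) by omega, chainZ_even, Nat.sub_add_cancel (by omega)]
    exact smul_ne_zero (pow_ne_zero _ (by norm_num)) (hne n (by omega) le_rfl).2
  -- In the superidentity for `e_2, e_2, y_1` all terms contain `[e_2, y_1] = 0` except `[[e_2,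
  -- e_2], y_1]`, a multiple of the nonzero end of the chain whose factor is `γ` times a power of 2.
  have hγ : γ = 0 := by
    have h1 := hA.even_left (E 2) (hE 2).2 hz0
    rw [hw, hww, map_zero, LinearMap.map_smul₂, hT.chainZ_succ, map_zero, LinearMap.zero_apply,
      sub_zero, show 2 * n - 3 + 1 = 2 * n - 2 by omega, eq_comm, smul_eq_zero,
      mul_eq_zero] at h1
    exact (h1.resolve_right htop).resolve_right (pow_ne_zero _ two_ne_zero)
  refine ⟨hγ, chainZ E Y, E 2,
    { leib := hA
      three_le := hn
      bracket_mem_N := fun x y => hN.prop.2.2 (Submodule.apply_mem_map₂ _ trivial trivial)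
      finrank_eq := hfin
      z_mem := fun j => ?_
      w_mem := (hE 2).1
      z_even := fun j => ?_
      z_odd := fun j => ?_
      w_even := (hE 2).2
      z_succ := hT.chainZ_succ
      z_top := htop
      z_zero := fun j hj => hT.chainZ_eq_zero hj
      w_ne := (hne 2 (by omega) (by omega)).1
      w_z := hw
      z_w := hT.chainZ_zero_E_two
      p_zero := ?_
      p_one := ?_
      w_w := by rw [hww, hγ, zero_mul, zero_smul] }⟩
  · rw [chainZ]
    split_ifs
    · exact (hE 1).1
    · exact Submodule.smul_mem _ _ (hY _).1
    · exact Submodule.smul_mem _ _ (hE _).1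
  · rw [chainZ_even]
    exact Submodule.smul_mem _ _ (hY _).2
  · rcases j with _ | j
    · rw [mul_zero, zero_add, chainZ_one]; exact (hE 1).2
    · rw [show 2 * (j + 1) + 1 = 2 * j + 3 by ring, chainZ_odd]
      exact Submodule.smul_mem _ _ (hE _).2
  · rw [chainCoeff, if_neg (by omega), if_neg (by omega), mul_zero]
  · rw [chainCoeff, if_neg (by omega), if_neg (by omega), mul_zero]

lemma ofTable_bracket_apply {ι : Type*} [Fintype ι] (par : ι → ZMod 2) (T : ι → ι → ι → ℂ)
    (hT : ∀ p q, T p q ∈ tablePart par (par p + par q)) (u v : ι → ℂ) :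
    (ofTable par T hT).bracket u v = ∑ p, ∑ q, (u p * v q) • T p q := by
  simp only [ofTable, Module.Basis.constr_apply_fintype, LinearMap.sum_apply, LinearMap.smul_apply,
    Pi.basisFun_equivFun, LinearEquiv.refl_apply, Finset.smul_sum, smul_smul]

lemma nE_apply_of_ne (n : ℕ) {k l : ℕ} (hl : l < n) (hkl : k ≠ l + 1) :
    nE n k (.inl ⟨l, hl⟩) = 0 := by
  simp only [nE]
  rw [if_neg (by simpa using hkl.symm)]

/-- If all parameters vanish, then `e_2` spans a direct summand. -/
lemma isSplit_familyH {n : ℕ} (hn : 3 ≤ n) {β : ℕ → ℂ} (hβ : ∀ k ∈ Finset.Icc 4 n, β k = 0) :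
    (familyH n β 0 0).IsSplit := by
  have hsum : ∀ r ≤ n, ∀ f : ℕ → NIdx n → ℂ, ∑ k ∈ Finset.Icc 4 r, β k • f k = 0 := by
    intro r hr f
    refine Finset.sum_eq_zero fun k hk => ?_
    rw [hβ k (Finset.Icc_subset_Icc_right hr hk), zero_smul]
  let o : NIdx n := .inl ⟨1, by omega⟩
  have hTl : ∀ p, hTable n β 0 0 (nE n) (nY n) p o = 0 := by
    rintro (⟨i, hi⟩ | ⟨i, hi⟩)
    · simp only [o, hTable, hEE]
      rw [if_neg (by omega), if_pos trivial, hsum n le_rfl]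
      split_ifs
      · rfl
      · simp
      · exact hsum _ (by omega) _
      · rfl
    · simp only [o, hTable, hYE]
      rw [if_neg (by omega), if_pos trivial, hsum n le_rfl]
      split_ifs
      · simp
      · exact hsum _ (by omega) _
      · rfl
  have hTr : ∀ q, hTable n β 0 0 (nE n) (nY n) o q = 0 := by
    rintro (⟨i, hi⟩ | ⟨i, hi⟩)
    · simp only [o, hTable, hEE]
      split_ifs <;> first | omega | simp
    · simp only [o, hTable, hEY]
      split_ifs <;> first | omega | simp
  have hTo : ∀ p q, hTable n β 0 0 (nE n) (nY n) p q o = 0 := by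
    rintro (⟨i, hi⟩ | ⟨i, hi⟩) (⟨j, hj⟩ | ⟨j, hj⟩)
    · rcases (show j = 1 ∨ j ≠ 1 by omega) with rfl | hj1
      · exact congrFun (hTl (.inl ⟨i, hi⟩)) o
      · simp only [o, hTable, hEE]
        split_ifs <;> first | omega | rfl | exact nE_apply_of_ne n _ (by omega)
    · simp only [o, hTable, hEY]
      split_ifs <;> simp [nY]
    · rcases (show j = 1 ∨ j ≠ 1 by omega) with rfl | hj1
      · exact congrFun (hTl (.inr ⟨i, hi⟩)) o
      · simp only [o, hTable, hYE]
        split_ifs <;> first | omega | rfl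
    · simp only [o, hTable, hYY]
      split_ifs <;> first | rfl | exact nE_apply_of_ne n _ (by omega)
  have hleft : ∀ x, (familyH n β 0 0).bracket x (Pi.single o 1) = 0 := by
    intro x
    rw [familyH, ofTable_bracket_apply]
    refine Finset.sum_eq_zero fun p _ => Finset.sum_eq_zero fun q _ => ?_
    rcases eq_or_ne q o with rfl | hq
    · rw [hTl, smul_zero]
    · rw [Pi.single_eq_of_ne hq, mul_zero, zero_smul]
  have hright : ∀ x, (familyH n β 0 0).bracket (Pi.single o 1) x = 0 := by
    intro x
    rw [familyH, ofTable_bracket_apply]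
    refine Finset.sum_eq_zero fun p _ => Finset.sum_eq_zero fun q _ => ?_
    rcases eq_or_ne p o with rfl | hp
    · rw [hTr, smul_zero]
    · rw [Pi.single_eq_of_ne hp, zero_mul, zero_smul]
  have hcoord : ∀ x y, (familyH n β 0 0).bracket x y o = 0 := by
    intro x y
    rw [familyH, ofTable_bracket_apply]
    simp only [Finset.sum_apply, Pi.smul_apply, hTo, smul_zero, Finset.sum_const_zero]
  have ho : (Pi.single o 1 : NIdx n → ℂ) ∈ (familyH n β 0 0).part 0 := by
    intro p hp
    rw [Pi.single_eq_of_ne]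
    rintro rfl
    exact hp rfl
  -- With all parameters zero, `e_2` annihilates from both sides and occurs in no product, so the
  -- hyperplane of vectors without an `e_2` coordinate is a complementary ideal.
  let J : Submodule ℂ (NIdx n → ℂ) := LinearMap.ker (LinearMap.proj o)
  have hJ : ∀ v, v ∈ J ↔ v o = 0 := fun v => by simp [J]
  refine ⟨Submodule.span ℂ {Pi.single o 1}, J, ⟨?_, ?_, ?_⟩, ⟨?_, ?_, ?_⟩, ?_, ?_, ?_⟩
  · intro v hv
    refine Submodule.mem_sup_left ⟨hv, ?_⟩
    exact (Submodule.span_singleton_le_iff_mem _ _).mpr ho hv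
  · intro x y hy
    obtain ⟨c, rfl⟩ := Submodule.mem_span_singleton.mp hy
    rw [map_smul, hleft]; simp
  · intro x y hx
    obtain ⟨c, rfl⟩ := Submodule.mem_span_singleton.mp hx
    rw [LinearMap.map_smul₂, hright]; simp
  · intro v hv
    obtain ⟨a, ha, b, hb, rfl⟩ := (familyH n β 0 0).exists_even_add_odd v
    have hbo : b o = 0 := hb o (by simp [o, nPar])
    rw [hJ, Pi.add_apply, hbo, add_zero] at hv
    exact Submodule.add_mem_sup ⟨(hJ a).mpr hv, ha⟩ ⟨(hJ b).mpr hbo, hb⟩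
  · intro x y _
    exact (hJ _).mpr (hcoord x y)
  · intro x y _
    exact (hJ _).mpr (hcoord x y)
  · simp
  · intro hbot
    have : (Pi.single (.inl ⟨0, by omega⟩) 1 : NIdx n → ℂ) ∈ J := by
      rw [hJ, Pi.single_eq_of_ne (by simp [o])]
    rw [hbot, Submodule.mem_bot] at this
    simp at this
  · rw [isCompl_iff, codisjoint_iff, Submodule.disjoint_def]
    constructor
    · intro v hv hvJ
      obtain ⟨c, rfl⟩ := Submodule.mem_span_singleton.mp hv
      rw [hJ] at hvJ
      have : c = 0 := by simpa using hvJ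
      rw [this, zero_smul]
    · rw [Submodule.eq_top_iff']
      intro v
      rw [show v = v o • Pi.single o 1 + (v - v o • Pi.single o 1) by abel]
      refine Submodule.add_mem_sup (Submodule.smul_mem _ _ (Submodule.mem_span_singleton_self _)) ?_
      rw [hJ]; simp

lemma exists_chainCoeff_ne_zero {n : ℕ} (hn : 3 ≤ n) {β : ℕ → ℂ} {δ : ℂ}
    (h : ¬ (familyH n β δ 0).IsSplit) : ∃ m < n, chainCoeff n β δ m ≠ 0 := by
  by_contra! hcon
  have hδ : δ = 0 := by
    have := hcon (n - 1) (by omega)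
    rw [chainCoeff, if_pos (by omega)] at this
    exact (mul_eq_zero.mp this).resolve_left (pow_ne_zero _ two_ne_zero)
  subst hδ
  refine h (isSplit_familyH hn fun k hk => ?_)
  have hk' := Finset.mem_Icc.mp hk
  have := hcon (k - 2) (by omega)
  rw [chainCoeff, if_neg (by omega), if_pos (by omega), Nat.sub_add_cancel (by omega)] at this
  exact (mul_eq_zero.mp this).resolve_left (pow_ne_zero _ two_ne_zero)

end Family

/-! ### Invariants that separate the members of the list. -/

section Invariants

variable {V W : Type*} [AddCommGroup V] [Module ℂ V] [AddCommGroup W] [Module ℂ W]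

/-- The products of `z j = R^j (z 0)`, where `R` is the right multiplication by `z 0`, and of `w`,
as far as they are needed to tell the superalgebras `SH` apart. -/
structure ChainFacts (A : SuperAlgebra V) (n m : ℕ) (q γ : ℂ) (z : ℕ → V) (w : V) : Prop where
  three_le : 3 ≤ n
  lt : m < n
  z_succ : ∀ j, A.bracket (z j) (z 0) = z (j + 1)
  w_z : A.bracket w (z 0) = 0
  z_w : ∀ i, A.bracket (z (2 * i)) w = q • z (2 * i + 2 * m)
  w_w : A.bracket w w = (γ * 2 ^ (n - 2)) • z (2 * n - 3)
  z_top : z (2 * n - 2) ≠ 0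
  z_zero : ∀ j, 2 * n - 1 ≤ j → z j = 0
  w_ne : w ≠ 0
  w_even : w ∈ A.part 0
  z0_odd : z 0 ∈ A.part 1
  exists_expansion : ∀ u ∈ A.part 1, ∃ c : ℕ → ℂ, u = ∑ i ∈ Finset.range n, c i • z (2 * i)
  bracket_z : ∀ u i, 1 ≤ i → A.bracket u (z (2 * i)) = 0
  eq_smul_w : ∀ u ∈ A.part 0, A.bracket u (z 0) = 0 → ∃ d : ℂ, u = d • w

lemma Isomorphic.symm {A : SuperAlgebra V} {B : SuperAlgebra W} (h : Isomorphic A B) :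
    Isomorphic B A := by
  obtain ⟨f, hf, hfp⟩ := h
  refine ⟨f.symm, fun x y => ?_, fun α x => ?_⟩
  · rw [LinearEquiv.symm_apply_eq, hf]; simp
  · rw [← hfp]; simp

lemma Isomorphic.trans {U : Type*} [AddCommGroup U] [Module ℂ U] {A : SuperAlgebra V}
    {B : SuperAlgebra W} {C : SuperAlgebra U} (h : Isomorphic A B) (h' : Isomorphic B C) :
    Isomorphic A C := by
  obtain ⟨f, hf, hfp⟩ := h
  obtain ⟨g, hg, hgp⟩ := h'
  exact ⟨f.trans g, fun x y => by simp [hf, hg], fun α x => by simp [hfp, hgp]⟩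

/-- The odd vector `f (z 0)` is `a z' 0` plus higher terms that act by zero from the right, and `f w
= b w'` because `w` spans the even vectors killed by `z 0`. The two relations are the images of `[z
0, w]` and `[w, w]`. -/
lemma ChainFacts.param_eq {A : SuperAlgebra V} {B : SuperAlgebra W} {n m m' : ℕ} {q q' γ γ' : ℂ}
    {z : ℕ → V} {w : V} {z' : ℕ → W} {w' : W} (h : ChainFacts A n m q γ z w)
    (h' : ChainFacts B n m' q' γ' z' w') (hAB : Isomorphic A B) :
    (q = 0 ↔ q' = 0) ∧ (q ≠ 0 → m = m') ∧
      ∃ a b : ℂ, a ≠ 0 ∧ b ≠ 0 ∧ a ^ (2 * m) * q = b * q' ∧ a ^ (2 * n - 2) * γ = b ^ 2 * γ' := by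
  obtain ⟨f, hf, hfp⟩ := hAB
  have h3 := h.three_le
  have hmn := h.lt
  have hmn' := h'.lt
  obtain ⟨c, hc⟩ := h'.exists_expansion (f (z 0)) ((hfp 1 _).mpr h.z0_odd)
  set a := c 0 with ha
  -- These are the shifts of `f (z 0)` under right multiplication by `z' 0`; as `f (z 0)` acts from
  -- the right by `a` times that operator, `f (z k) = a^k y k`.
  let y : ℕ → W := fun k => ∑ i ∈ Finset.range n, c i • z' (2 * i + k)
  have hy0 : f (z 0) = y 0 := by rw [hc]; rfl
  have hright : ∀ u, B.bracket u (y 0) = a • B.bracket u (z' 0) := by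
    intro u
    rw [← hy0, hc, map_sum, Finset.sum_eq_single 0]
    · rw [map_smul]
    · intro i _ hi
      rw [map_smul, h'.bracket_z _ _ (by omega), smul_zero]
    · intro h0; exact absurd (Finset.mem_range.mpr (by omega)) h0
  have hysucc : ∀ k, B.bracket (y k) (z' 0) = y (k + 1) := by
    intro k
    simp only [y, map_sum, LinearMap.sum_apply, LinearMap.map_smul₂, h'.z_succ, add_assoc]
  have hfz : ∀ k, f (z k) = a ^ k • y k := by
    intro k
    induction k with
    | zero => rw [hy0, pow_zero, one_smul]
    | succ k ih =>
      rw [← h.z_succ, hf, hy0, hright, ih, LinearMap.map_smul₂, hysucc, smul_smul, pow_succ']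
  have hyhigh : ∀ k, 2 * n - 1 ≤ k → y k = 0 := by
    intro k hk
    refine Finset.sum_eq_zero fun i _ => ?_
    rw [h'.z_zero _ (by omega), smul_zero]
  have hylead : ∀ k, 2 * n - 3 ≤ k → y k = a • z' k := by
    intro k hk
    simp only [y]
    rw [Finset.sum_eq_single 0]
    · rw [mul_zero, zero_add]
    · intro i _ hi
      rw [h'.z_zero _ (by omega), smul_zero]
    · intro h0; exact absurd (Finset.mem_range.mpr (by omega)) h0
  have ha0 : a ≠ 0 := by
    intro ha0
    have : f (z (2 * n - 2)) = 0 := by rw [hfz, hylead _ (by omega), ha0]; simp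
    exact h.z_top (by simpa using this)
  have hytop : y (2 * n - 2) ≠ 0 := by
    rw [hylead _ (by omega)]; exact smul_ne_zero ha0 h'.z_top
  have hpow : ∀ k l, (B.bracket.flip (z' 0) ^ k) (y l) = y (l + k) := by
    intro k l
    induction k with
    | zero => simp
    | succ k ih => rw [pow_succ', Module.End.mul_apply, ih]; exact hysucc (l + k)
  obtain ⟨b, hb⟩ := h'.eq_smul_w (f w) ((hfp 0 _).mpr h.w_even) (by
    have h1 := hf w (z 0)
    rw [h.w_z, map_zero, hy0, hright] at h1
    exact (smul_eq_zero.mp h1.symm).resolve_left ha0)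
  have hb0 : b ≠ 0 := by
    rintro rfl
    rw [zero_smul] at hb
    exact h.w_ne (by simpa using hb)
  have hrel : (a ^ (2 * m) * q) • y (2 * m) = (b * q') • y (2 * m') := by
    have h1 := hf (z 0) w
    have h2 := h.z_w 0
    rw [mul_zero, zero_add] at h2
    rw [h2, map_smul, hfz, hb, map_smul, hc, map_sum, LinearMap.sum_apply] at h1
    simp only [LinearMap.map_smul₂, h'.z_w, smul_comm _ q'] at h1
    rw [← Finset.smul_sum, smul_smul, smul_smul, mul_comm q] at h1
    exact h1
  -- Shifting `y (2k)` to the end of the chain kills `y (2l)`, so vectors of different degree are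
  -- not proportional; this makes `m` an invariant when `q ≠ 0`.
  have hzero : ∀ (s t : ℂ) (k l : ℕ), k < n → k < l →
      s • y (2 * k) = t • y (2 * l) → s = 0 := by
    intro s t k l hk hkl hst
    have := congrArg (B.bracket.flip (z' 0) ^ (2 * n - 2 - 2 * k)) hst
    rw [map_smul, map_smul, hpow, hpow, hyhigh (2 * l + _) (by omega), smul_zero,
      show 2 * k + (2 * n - 2 - 2 * k) = 2 * n - 2 by omega] at this
    exact (smul_eq_zero.mp this).resolve_right hytop
  have hyne : ∀ k < n, y (2 * k) ≠ 0 := by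
    intro k hk h0
    have := hpow (2 * n - 2 - 2 * k) (2 * k)
    rw [h0, map_zero, show 2 * k + (2 * n - 2 - 2 * k) = 2 * n - 2 by omega] at this
    exact hytop this.symm
  have hqq : q = 0 ↔ q' = 0 := by
    constructor
    · rintro rfl
      rw [mul_zero, zero_smul, eq_comm, smul_eq_zero, mul_eq_zero] at hrel
      exact (hrel.resolve_right (hyne m' hmn')).resolve_left hb0
    · rintro rfl
      rw [mul_zero, zero_smul, smul_eq_zero, mul_eq_zero] at hrel
      exact (hrel.resolve_right (hyne m hmn)).resolve_left (pow_ne_zero _ ha0)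
  have hmm : q ≠ 0 → m = m' := by
    intro hq
    by_contra hne
    rcases Nat.lt_or_gt_of_ne hne with hlt | hgt
    · exact mul_ne_zero (pow_ne_zero _ ha0) hq (hzero _ _ _ _ hmn hlt hrel)
    · exact mul_ne_zero hb0 (fun h0 => hq (hqq.mpr h0))
        (hzero _ _ _ _ hmn' hgt hrel.symm)
  refine ⟨hqq, hmm, a, b, ha0, hb0, ?_, ?_⟩
  · rcases eq_or_ne q 0 with hq | hq
    · rw [hq, hqq.mp hq, mul_zero, mul_zero]
    · have hm := hmm hq
      subst hm
      exact smul_left_injective ℂ (hyne m hmn) hrel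
  -- At degree `2n - 3` only the leading term of `y` survives. It supplies one more factor `a`,
  -- whence the exponent `2n - 2`.
  · have h1 := hf w w
    have hz3 : z' (2 * n - 3) ≠ 0 := by
      intro h0
      have := h'.z_succ (2 * n - 3)
      rw [h0, map_zero, LinearMap.zero_apply, show 2 * n - 3 + 1 = 2 * n - 2 by omega] at this
      exact h'.z_top this.symm
    rw [h.w_w, map_smul, hfz, hylead _ le_rfl, hb, map_smul, LinearMap.map_smul₂, h'.w_w] at h1
    simp only [smul_smul] at h1
    have h2 := smul_left_injective ℂ hz3 h1
    have h3 : (2 : ℂ) ^ (n - 2) ≠ 0 := pow_ne_zero _ two_ne_zero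
    refine mul_right_cancel₀ h3 ?_
    rw [show 2 * n - 2 = 2 * n - 3 + 1 by omega, pow_succ]
    linear_combination h2

lemma lE_eq_single (n : ℕ) (i : Fin n) : lE n (i.val + 1) = Pi.single (.inl (.inl i)) 1 := by
  funext p
  rcases p with p | u
  · have := congrFun (nE_eq_single n i) p
    simp only [lE, this, Pi.single_apply, Sum.inl.injEq]
  · simp [lE]

lemma lY_eq_single (n : ℕ) (i : Fin n) : lY n (i.val + 1) = Pi.single (.inl (.inr i)) 1 := by
  funext p
  rcases p with p | u
  · have := congrFun (nY_eq_single n i) p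
    simp only [lY, this, Pi.single_apply, Sum.inl.injEq]
  · simp [lY]

lemma lE_eq_zero {n k : ℕ} (hk : n < k) : lE n k = 0 := by
  funext p
  rcases p with p | u
  · exact congrFun (nE_eq_zero hk) p
  · rfl

lemma lY_eq_zero {n k : ℕ} (hk : n < k) : lY n k = 0 := by
  funext p
  rcases p with p | u
  · exact congrFun (nY_eq_zero hk) p
  · rfl

lemma hasHTable_shExt {n : ℕ} (hn : 3 ≤ n) (β : ℕ → ℂ) (δ γ b c : ℂ) (s : ℕ) :
    HasHTable (shExt n β δ γ b c s) n β δ γ (lE n) (lY n) := by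
  refine HasHTable.of_table hn (fun k hk => lE_eq_zero hk) (fun k hk => lY_eq_zero hk) ?_
  have hvec : ∀ p, nVec n (lE n) (lY n) p = Pi.single (.inl p) 1 := by
    rintro (i | i) <;> simp only [nVec]
    · rw [lE_eq_single]
    · rw [lY_eq_single]
  intro p q
  rw [hvec, hvec]
  exact ofTable_bracket_single _ _ _ _ _

lemma shExt_bracket_single {n : ℕ} (β : ℕ → ℂ) (δ γ b c : ℂ) (s : ℕ) (u : LIdx n → ℂ) (o : LIdx n) :
    (shExt n β δ γ b c s).bracket u (Pi.single o 1) =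
      ∑ p, u p • shTable n β δ γ b c s p o := by
  rw [shExt, ofTable_bracket_apply]
  refine Finset.sum_congr rfl fun p _ => ?_
  rw [Finset.sum_eq_single o]
  · rw [Pi.single_eq_same, mul_one]
  · intro q _ hq; rw [Pi.single_eq_of_ne hq, mul_zero, zero_smul]
  · intro h; exact absurd (Finset.mem_univ o) h

/-- Right multiplication by `y_1` sends `x`, `e_1` and each `e_i` with `i ≥ 3` to nonzero multiples
of `y_1`, `y_2` and `y_i`. These are independent, so only `e_2` is left in the even kernel. -/
lemma shExt_eq_smul {n : ℕ} (hn : 3 ≤ n) (β : ℕ → ℂ) (δ γ b c : ℂ) (s : ℕ) (u : LIdx n → ℂ)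
    (hu : u ∈ tablePart (lPar n) 0) (hu0 : (shExt n β δ γ b c s).bracket u (lY n 1) = 0) :
    ∃ d : ℂ, u = d • lE n 2 := by
  have h1 := lY_eq_single n ⟨0, by omega⟩
  have h2 := lE_eq_single n ⟨1, by omega⟩
  simp only [zero_add] at h1
  rw [h1, shExt_bracket_single, Fintype.sum_sum_type, Fintype.sum_sum_type] at hu0
  have hodd : ∀ i, u (.inl (.inr i)) = 0 := fun i => hu _ (by simp [lPar, nPar])
  have hcoord : ∀ k : Fin n, (∑ i : Fin n, u (.inl (.inl i)) *
      hEY (lY n) (i.val + 1) 1 (.inl (.inr k))) + u (.inr ()) * -lY n 1 (.inl (.inr k)) = 0 := by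
    intro k
    have := congrFun hu0 (.inl (.inr k))
    simpa [hodd, shTable, hTable, Finset.sum_apply] using this
  have hlY : ∀ (l : ℕ) (k : Fin n), lY n l (.inl (.inr k)) = if k.val + 1 = l then 1 else 0 :=
    fun l k => rfl
  have hEYc : ∀ i k : Fin n, hEY (lY n) (i.val + 1) 1 (.inl (.inr k)) =
      if (i.val = 0 ∧ k.val = 1) ∨ (2 ≤ i.val ∧ k = i) then 1 / 2 else 0 := by
    intro i k
    unfold hEY
    rw [if_pos rfl]
    split_ifs with h1 h2 h3 h4 h5 <;>
      simp only [Pi.smul_apply, hlY, Pi.zero_apply, smul_eq_mul] <;>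
      simp only [Fin.ext_iff] at * <;>
      first
      | omega
      | rfl
      | (rw [if_pos (by omega)]; ring)
      | (rw [if_neg (by omega)]; ring)
  simp only [hEYc, hlY] at hcoord
  have hx : u (.inr ()) = 0 := by
    have := hcoord ⟨0, by omega⟩
    rw [Finset.sum_eq_zero] at this
    · simpa using this
    · intro i _
      rw [if_neg, mul_zero]
      simp only [Fin.ext_iff]; omega
  have hE : ∀ i : Fin n, i.val ≠ 1 → u (.inl (.inl i)) = 0 := by
    intro i hi
    rw [hx] at hcoord
    rcases Nat.eq_zero_or_pos i.val with h0 | h0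
    · have := hcoord ⟨1, by omega⟩
      rw [Finset.sum_eq_single i] at this
      · rw [if_pos (Or.inl ⟨h0, rfl⟩)] at this
        simpa using this
      · intro j _ hj
        rw [if_neg, mul_zero]
        simp only [Fin.ext_iff] at hj ⊢; omega
      · simp
    · have := hcoord i
      rw [Finset.sum_eq_single i] at this
      · rw [if_pos (Or.inr ⟨by omega, rfl⟩)] at this
        simpa using this
      · intro j _ hj
        rw [if_neg, mul_zero]
        simp only [Fin.ext_iff] at hj ⊢; omega
      · simp
  refine ⟨u (.inl (.inl ⟨1, by omega⟩)), ?_⟩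
  rw [h2]
  funext p
  rcases p with (i | i) | _
  · rcases eq_or_ne i ⟨1, by omega⟩ with rfl | hi
    · simp
    · rw [hE i (by simpa [Fin.ext_iff] using hi)]; simp [hi]
  · rw [hodd]; simp
  · rw [hx]; simp

lemma chainFacts_shExt {n : ℕ} (hn : 3 ≤ n) {β : ℕ → ℂ} {δ : ℂ} (γ b c : ℂ) (s : ℕ) {m : ℕ} {a : ℂ}
    (hm : 2 ≤ m) (hmn : m < n) (hβ : ∀ k ≤ n, β k = if k = m + 2 then a else 0)
    (hδ : δ = if m + 1 = n then a else 0) :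
    ChainFacts (shExt n β δ γ b c s) n m (a * 2 ^ m) γ (chainZ (lE n) (lY n)) (lE n 2) := by
  have hT := hasHTable_shExt hn β δ γ b c s
  have h2 := lE_eq_single n ⟨1, by omega⟩
  have h1 := lY_eq_single n ⟨0, by omega⟩
  have htop := lY_eq_single n ⟨n - 1, by omega⟩
  simp only [zero_add, Nat.sub_add_cancel (show 1 ≤ n by omega)] at h1 htop
  exact
    { three_le := hn
      lt := hmn
      z_succ := hT.chainZ_succ
      w_z := hT.E_two_chainZ
      z_w := hT.chainZ_even_E_two hm hmn hβ hδ
      w_w := hT.E_two_E_two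
      z_top := by
        rw [show 2 * n - 2 = 2 * (n - 1) by omega, chainZ_even, Nat.sub_add_cancel (by omega), htop]
        exact smul_ne_zero (pow_ne_zero _ (by norm_num)) (by simp)
      z_zero := fun j hj => hT.chainZ_eq_zero hj
      w_ne := by rw [h2]; simp
      w_even := by
        rw [h2]
        intro p hp
        rw [Pi.single_eq_of_ne]
        rintro rfl
        exact hp rfl
      z0_odd := by
        rw [chainZ_zero, h1]
        intro p hp
        rw [Pi.single_eq_of_ne]
        rintro rfl
        exact hp rfl
      exists_expansion := by
        intro u hu
        refine ⟨fun i => if hi : i < n then 2 ^ i * u (.inl (.inr ⟨i, hi⟩)) else 0, ?_⟩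
        rw [Finset.sum_range]
        have : ∀ i : Fin n, (if hi : i.val < n then (2 ^ i.val * u (.inl (.inr ⟨i, hi⟩))) else 0) •
            chainZ (lE n) (lY n) (2 * i.val) =
            u (.inl (.inr i)) • Pi.single (.inl (.inr i)) (1 : ℂ) := by
          intro i
          rw [dif_pos i.2, mul_comm, mul_smul, two_pow_smul_chainZ_even, lY_eq_single]
        rw [Finset.sum_congr rfl fun i _ => this i]
        funext p
        rw [Finset.sum_apply]
        rcases p with (i | i) | v
        · rw [hu _ (by simp [lPar, nPar])]
          simp
        · simp [Pi.single_apply]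
        · rw [hu _ (by simp [lPar])]
          simp
      bracket_z := by
        intro u i hi
        rw [chainZ_even, map_smul]
        rcases Nat.lt_or_ge i n with hin | hin
        · rw [lY_eq_single n ⟨i, hin⟩, shExt_bracket_single, Finset.sum_eq_zero, smul_zero]
          rintro ((j | j) | v) _
          · simp only [shTable, hTable, hEY]
            rw [if_neg (by omega), smul_zero]
          · simp only [shTable, hTable, hYY]
            rw [if_neg (by omega), smul_zero]
          · simp only [shTable]
            rw [if_neg (by omega), smul_zero]
        · rw [lY_eq_zero (by omega)]; simp
      eq_smul_w := by
        intro u hu hu0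
        rw [chainZ_zero] at hu0
        exact shExt_eq_smul hn β δ γ b c s u hu hu0 }

/-- The degree of the right multiplication by `e_2` with respect to the chain. -/
def SHLabel.deg {n : ℕ} : SHLabel n → ℕ
  | .sh1 t _ _ => t - 2
  | .sh2 => n - 1
  | .sh3 _ _ _ _ => (n - 1) / 2
  | .sh4 => n - 1

/-- The nonzero one among the parameters `β₄, …, βₙ, δ`, if there is one. -/
def SHLabel.coeff {n : ℕ} : SHLabel n → ℂ
  | .sh4 => 0
  | _ => 1

/-- The parameter `γ`. -/
def SHLabel.gamma {n : ℕ} : SHLabel n → ℂ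
  | .sh1 _ _ _ => 0
  | .sh2 => 0
  | .sh3 γ _ _ _ => γ
  | .sh4 => 1

lemma chainFacts_SH {n : ℕ} (hn : 3 ≤ n) (l : SHLabel n) :
    ChainFacts (SH n l) n l.deg (l.coeff * 2 ^ l.deg) l.gamma (chainZ (lE n) (lY n)) (lE n 2) := by
  rcases l with ⟨t, h4, htn⟩ | _ | ⟨γ, hγ, hodd, h5⟩ | _
  · refine chainFacts_shExt hn _ _ _ _ (m := t - 2) (a := 1) (by omega) (by omega)
      (fun k _ => ?_) (by rw [if_neg (by omega)])
    rw [Nat.sub_add_cancel (by omega)]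
  · refine chainFacts_shExt hn _ _ _ _ (m := n - 1) (a := 1) (by omega) (by omega)
      (fun k _ => ?_) (by rw [if_pos (by omega)])
    rw [if_neg (by omega)]
  · obtain ⟨j, hj⟩ := hodd
    refine chainFacts_shExt hn _ _ _ _ (m := (n - 1) / 2) (a := 1) (by omega) (by omega)
      (fun k _ => ?_) (by rw [if_neg (by omega)])
    rw [show (n - 1) / 2 + 2 = (n + 3) / 2 by omega]
  -- With zero coefficient the degree carries no information; `n - 1` is an arbitrary admissible
  -- value.
  · exact chainFacts_shExt hn _ _ _ _ (m := n - 1) (a := 0) (by omega) (by omega)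
      (fun k _ => by simp) (by simp)

/-- The superalgebras `SH` are pairwise non-isomorphic. -/
theorem SH_injective {n : ℕ} (hn : 3 ≤ n) (l l' : SHLabel n)
    (h : Isomorphic (SH n l) (SH n l')) : l = l' := by
  obtain ⟨hq, hm, a, b, ha, hb, hab, hγ⟩ := (chainFacts_SH hn l).param_eq (chainFacts_SH hn l') h
  have h2 : ∀ k, (2 : ℂ) ^ k ≠ 0 := fun k => pow_ne_zero _ two_ne_zero
  simp only [mul_eq_zero, h2, or_false, ne_eq] at hq hm
  rcases l with ⟨t, h4, htn⟩ | _ | ⟨γ, hγ0, hodd, h5⟩ | _ <;>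
    rcases l' with ⟨t', h4', htn'⟩ | _ | ⟨γ', hγ0', hodd', h5'⟩ | _ <;>
    simp only [SHLabel.deg, SHLabel.coeff, SHLabel.gamma, one_ne_zero, not_false_eq_true,
      true_implies, false_iff, iff_false, not_true_eq_false, mul_zero, zero_eq_mul, mul_eq_zero,
      pow_eq_zero_iff', ha, hb, false_and, false_or] at hq hm hγ
  · congr; omega
  · omega
  · exact absurd hγ hγ0'
  · omega
  · rfl
  · exact absurd hγ hγ0'
  · exact absurd hγ hγ0
  · exact absurd hγ hγ0
  · simp only [SHLabel.deg, SHLabel.coeff, one_mul] at hab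
    have hb' := mul_right_cancel₀ (h2 _) hab
    -- For `SH3` the degree is `(n - 1) / 2`, so `a ^ (n - 1) = b`. The scaling factors of `γ` and
    -- `γ'` then coincide, and `γ` cannot be normalized away.
    have hpow : b ^ 2 = a ^ (2 * n - 2) := by
      obtain ⟨j, hj⟩ := hodd
      rw [← hb', ← pow_mul]; congr 1; omega
    rw [← hpow] at hγ
    have := mul_left_cancel₀ (pow_ne_zero 2 hb) hγ
    subst this
    rfl
  · rfl

end Invariants

end SuperAlgebra

/-! ### The classification. -/

theorem mainTheorem2 (n : ℕ) (hn : 3 ≤ n) :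
    (∀ (V : Type*) [AddCommGroup V] [Module ℂ V] [FiniteDimensional ℂ V] (A : SuperAlgebra V)
        (N : Submodule ℂ V) (hN : A.IsNilradical N) (β : ℕ → ℂ) (δ γ : ℂ),
        A.IsLeibniz → A.Solvable → ¬ A.NilpotentOn ⊤ →
        SuperAlgebra.Isomorphic (A.restrict N hN.prop.1) (SuperAlgebra.familyH n β δ γ) →
        ¬ (SuperAlgebra.familyH n β δ γ).IsSplit →
        Module.finrank ℂ (V ⧸ N) = 1 ∧
          ∃! l : SuperAlgebra.SHLabel n, SuperAlgebra.Isomorphic A (SuperAlgebra.SH n l)) ∧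
    (∀ l l' : SuperAlgebra.SHLabel n,
        SuperAlgebra.Isomorphic (SuperAlgebra.SH n l) (SuperAlgebra.SH n l') → l = l') := by
  refine ⟨?_, SuperAlgebra.SH_injective hn⟩
  intro V _ _ _ A N hN β δ γ hA _ hnil hiso hsplit
  obtain ⟨rfl, z, w, h⟩ := SuperAlgebra.exists_chainModel hn hN hA hiso
  have hp := SuperAlgebra.exists_chainCoeff_ne_zero hn hsplit
  obtain ⟨hfin, x, hx, hxN, hzx⟩ := h.finrank_quotient_eq_one hN hnil hp
  obtain ⟨m, z', w', x', hd⟩ := h.exists_isDiagonal hp hx hxN hzx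
  obtain ⟨l, hl⟩ := hd.exists_isomorphic_SH hfin
  exact ⟨hfin, l, hl, fun l' hl' => SuperAlgebra.SH_injective hn l' l (hl'.symm.trans hl)⟩
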